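/- Let $(\mathcal B,\mathbb E,\mathfrak s)$ be an extriangulated category in the sense of Nakaoka--Palu, with enough projectives and enough injectives. Let $\mathcal P$ and $\mathcal I$ be the full subcategories of projective objects ($\mathbb E(P,-)=0$) and of injective objects ($\mathbb E(-,I)=0$). A conflation is a sequence $A\to B\to C$ that realizes some $\delta\in\mathbb E(C,A)$. For full subcategories $\mathcal D_1,\mathcal D_2\subseteq\mathcal B$ let $\mathrm{Cone}(\mathcal D_1,\mathcal D_2)$ (resp. $\mathrm{CoCone}(\mathcal D_1,\mathcal D_2)$) be the full subcategory of those $X$ that admit a conflation $D_1\to D_2\to X$ (resp. $X\to D_1\to D_2$) with $D_1\in\mathcal D_1$, $D_2\in\mathcal D_2$. Put $\Sigma^0\mathcal D=\mathcal D$ and $\Sigma^{i}\mathcal D=\mathrm{Cone}(\Sigma^{i-1}\mathcal D,\mathcal I)$ for $i\ge 1$. For an object $Y$, let $\Sigma^iY$ be an $i$-fold iterated cosyzygy, obtained from conflations $\Sigma^{i}Y\to I^i\to\Sigma^{i+1}Y$ with $\Sigma^0Y=Y$ and $I^i\in\mathcal I$, and put $\mathbb E^{i}(X,Y)=\mathbb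 E(X,\Sigma^{i-1}Y)$ for $i\ge 1$. A cotorsion pair is a pair $(\mathcal U,\mathcal V)$ of full additive subcategories of $\mathcal B$, closed under isomorphisms and direct summands, with $\mathbb E(\mathcal U,\mathcal V)=0$ and $\mathcal B=\mathrm{Cone}(\mathcal V,\mathcal U)=\mathrm{CoCone}(\mathcal V,\mathcal U)$. Put $\mathcal W=\mathcal U\cap\mathcal V$, $\mathcal B^+=\mathrm{Cone}(\mathcal V,\mathcal W)$, $\mathcal B^-=\mathrm{CoCone}(\mathcal W,\mathcal U)$. For full subcategories $\mathcal C,\mathcal D\subseteq\mathcal B$, let $\mathcal B/\mathcal D$ be the quotient of $\mathcal B$ by the morphisms that factor through an object of $\mathcal D$, and let $\mathcal C/\mathcal D$ be the full subcategory of $\mathcal B/\mathcal D$ on the objects of $\mathcal C$. The heart of $(\mathcal U,\mathcal V)$ is $\underline{\mathcal H}=(\mathcal B^+\cap\mathcal B^-)/\mathcal W$. The associated functor $H\colon\mathcal B\to\underline{\mathcal H}$ is $\sigma^-\circ\sigma^+\circ\pi$, where $\pi\colon\mathcal B\to\mathcal B/\mathcal W$ is the quotient functor, $\sigma^+$ is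 the left adjoint of the inclusion $\mathcal B^+/\mathcal W\hookrightarrow\mathcal B/\mathcal W$, and $\sigma^-$ is the right adjoint of the inclusion $\mathcal B^- /\mathcal W\hookrightarrow\mathcal B/\mathcal W$; it is determined up to natural isomorphism. Two cotorsion pairs with hearts $\underline{\mathcal H},\underline{\mathcal H}'$ and associated functors $H,H'$ are heart-equivalent if there is an equivalence $E\colon\underline{\mathcal H}\to\underline{\mathcal H}'$ with $E\circ H\cong H'$. Let $n\ge 2$, and let $\mathcal M\subseteq\mathcal B$ be an $n$-cluster tilting subcategory: a full subcategory that is contravariantly finite and covariantly finite in $\mathcal B$ and such that, for every $X\in\mathcal B$, one has $X\in\mathcal M$ if and only if $\mathbb E^i(X,\mathcal M)=0$ for all $1\le i\le n-1$, and $X\in\mathcal M$ if and only if $\mathbb E^i(\mathcal M,X)=0$ for all $1\le i\le n-1$. Put $\mathcal M_1=\mathcal M$, $\mathcal M_\ell=\mathrm{Cone}(\mathcal M_{\ell-1},\mathcal M)$ for $\ell>1$, and $\mathcal Y_\ell=\Sigma^{\ell-1}\mathcal M_{n-\ell}$ for $1\le\ell\le n-1$. Then: 1. $(\mathcal M_\ell,\mathcal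 Y_\ell)$ is a cotorsion pair for every $1\le\ell\le n-1$, and its associated functor to the heart exists. 2. The cotorsion pairs $(\mathcal M_1,\mathcal Y_1),\dots,(\mathcal M_{n-1},\mathcal Y_{n-1})$ are mutually heart-equivalent. 3. For every $1\le\ell\le n-1$, the heart of $(\mathcal M_\ell,\mathcal Y_\ell)$ is equivalent to $\mathrm{mod}(\mathcal M/\mathcal P)$, the category of coherent functors over $\mathcal M/\mathcal P$, that is, of functors $F\colon(\mathcal M/\mathcal P)^{\mathrm{op}}\to\mathit{Ab}$ that admit an exact sequence $(\mathcal M/\mathcal P)(-,X)\to(\mathcal M/\mathcal P)(-,Y)\to F\to 0$ with $X,Y\in\mathcal M/\mathcal P$. -/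

import Mathlib

open CategoryTheory CategoryTheory.Limits Opposite

universe w v u

/-! ## Full subcategories and quotients of additive categories -/

section Additive

variable {B : Type u} [Category.{v} B] [Preadditive B] [HasBinaryBiproducts B]

/-- A full additive subcategory, closed under isomorphisms. -/
class IsAdditiveSubcategory (D : ObjectProperty B) : Prop where
  zero : ∀ X : B, IsZero X → D X
  biprod : ∀ X Y : B, D X → D Y → D (X ⊞ Y)
  iso : ∀ X Y : B, (X ≅ Y) → D X → D Y

/-- `D` is closed under direct summands. -/
def ClosedUnderSummands (D : ObjectProperty B) : Prop :=
  ∀ X Y : B, D (X ⊞ Y) → D X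

/-- Two parallel morphisms are identified in `B / D` if their difference factors through
an object of `D`. -/
def idealRel (D : ObjectProperty B) : HomRel B := fun X Y f g =>
  ∃ (Z : B) (a : X ⟶ Z) (b : Z ⟶ Y), D Z ∧ a ≫ b = f - g

/-- The quotient category `B / D`. -/
abbrev AddQuotient (D : ObjectProperty B) : Type u := Quotient (idealRel D)

/-- The canonical functor `B ⥤ B / D`. -/
abbrev toAddQuotient (D : ObjectProperty B) : B ⥤ AddQuotient D :=
  Quotient.functor (idealRel D)

/-- The objects of `B / D` that come from the full subcategory `C`. -/
abbrev inAddQuotient (C D : ObjectProperty B) : ObjectProperty (AddQuotient D) :=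
  fun X => C X.as

/-- `C / D`, the full subcategory of `B / D` on the objects of `C`. -/
abbrev SubQuotient (C D : ObjectProperty B) : Type u := (inAddQuotient C D).FullSubcategory

/-- The inclusion `C / D ⥤ B / D`. -/
abbrev subQuotientIncl (C D : ObjectProperty B) : SubQuotient C D ⥤ AddQuotient D :=
  (inAddQuotient C D).ι

lemma idealRel_add (D : ObjectProperty B) [IsAdditiveSubcategory D] {X Y : B}
    {f₁ f₂ g₁ g₂ : X ⟶ Y} (hf : idealRel D f₁ f₂) (hg : idealRel D g₁ g₂) :
    idealRel D (f₁ + g₁) (f₂ + g₂) := by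
  obtain ⟨Z, a, b, hZ, h⟩ := hf
  obtain ⟨Z', a', b', hZ', h'⟩ := hg
  refine ⟨Z ⊞ Z', biprod.lift a a', biprod.desc b b',
    IsAdditiveSubcategory.biprod _ _ hZ hZ', ?_⟩
  rw [biprod.lift_desc, h, h']
  abel

instance idealRel_congruence [HasZeroObject B] (D : ObjectProperty B) [IsAdditiveSubcategory D] :
    Congruence (idealRel D) where
  comp_left := by
    rintro X Y Z f g g' ⟨W, a, b, hW, h⟩
    exact ⟨W, f ≫ a, b, hW, by rw [Category.assoc, h, Preadditive.comp_sub]⟩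
  comp_right := by
    rintro X Y Z f f' g ⟨W, a, b, hW, h⟩
    exact ⟨W, a, b ≫ g, hW, by rw [← Category.assoc, h, Preadditive.sub_comp]⟩
  equivalence := by
    intro X Y
    have hrefl : ∀ f : X ⟶ Y, idealRel D f f := fun f => by
      obtain ⟨O, hO⟩ := (inferInstance : HasZeroObject B).zero
      exact ⟨O, 0, 0, IsAdditiveSubcategory.zero _ hO, by simp⟩
    refine ⟨hrefl, ?_, ?_⟩
    · rintro f g ⟨W, a, b, hW, h⟩
      exact ⟨W, -a, b, hW, by rw [Preadditive.neg_comp, h, neg_sub]⟩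
    · intro f g k h₁ h₂
      have h := idealRel_add D h₁ h₂
      obtain ⟨W, a, b, hW, h⟩ := h
      exact ⟨W, a, b, hW, by rw [h]; abel⟩

instance addQuotientPreadditive [HasZeroObject B] (D : ObjectProperty B) [IsAdditiveSubcategory D] :
    Preadditive (AddQuotient D) :=
  Quotient.preadditive (idealRel D) (fun _ _ _ _ _ _ hf hg => idealRel_add D hf hg)

end Additive

/-! ## Coherent functors -/

section Coherent

variable (D : Type u) [Category.{v} D] [Preadditive D]

/-- A functor `F : Dᵒᵖ ⥤ Ab` is coherent if there is an exact sequence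
`D(-, X) ⟶ D(-, Y) ⟶ F ⟶ 0`. -/
def IsCoherentFunctor : ObjectProperty (Dᵒᵖ ⥤ AddCommGrpCat.{v}) := fun F =>
  ∃ (X Y : D) (f : X ⟶ Y) (q : preadditiveYoneda.obj Y ⟶ F)
    (h : preadditiveYoneda.map f ≫ q = 0), Nonempty (IsColimit (CokernelCofork.ofπ q h))

/-- The category `mod D` of coherent functors over `D`. -/
abbrev CoherentMod : Type (max u (v + 1)) := (IsCoherentFunctor D).FullSubcategory

end Coherent

/-! ## Extriangulated categories -/

section ExtSequence

variable {B : Type u} [Category.{v} B]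

/-- A sequence of morphisms `A ⟶ mid ⟶ C`. -/
structure ExtSequence (A C : B) where
  /-- the middle term -/
  mid : B
  /-- the first morphism -/
  i : A ⟶ mid
  /-- the second morphism -/
  p : mid ⟶ C

/-- Equivalence of sequences with the same end terms. -/
instance ExtSequence.setoid (A C : B) : Setoid (ExtSequence A C) where
  r s t := ∃ b : s.mid ≅ t.mid, s.i ≫ b.hom = t.i ∧ b.hom ≫ t.p = s.p
  iseqv :=
    { refl := fun s => ⟨Iso.refl _, by simp, by simp⟩
      symm := by
        rintro s t ⟨b, h₁, h₂⟩
        exact ⟨b.symm, by simp [← h₁], by simp [← h₂]⟩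
      trans := by
        rintro s t r ⟨b, h₁, h₂⟩ ⟨c, h₃, h₄⟩
        exact ⟨b ≪≫ c, by simp [← h₃, ← h₁], by simp [h₄, h₂]⟩ }

end ExtSequence

/-- An additive bifunctor `E : Bᵒᵖ × B ⥤ Ab`, together with a correspondence `s` that sends every
extension `δ ∈ E(C, A)` to an equivalence class of sequences `A ⟶ mid ⟶ C`. -/
structure ExtStructure (B : Type u) [Category.{v} B] [Preadditive B] where
  /-- the bifunctor of extensions -/
  E : Bᵒᵖ ⥤ B ⥤ AddCommGrpCat.{w}
  additive_left : E.Additive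
  additive_right : ∀ C : Bᵒᵖ, (E.obj C).Additive
  /-- the realization -/
  s : ∀ {C A : B}, ((E.obj (op C)).obj A) → _root_.Quotient (ExtSequence.setoid A C)

namespace ExtStructure

variable {B : Type u} [Category.{v} B] [Preadditive B]

section Basic

variable (S : ExtStructure.{w} B)

/-- The group `E(C, A)` of extensions of `C` by `A`. -/
abbrev Ext (C A : B) : Type w := (S.E.obj (op C)).obj A

variable {S}

/-- `a_* δ`. -/
def push {C A A' : B} (a : A ⟶ A') (δ : S.Ext C A) : S.Ext C A' :=
  (S.E.obj (op C)).map a δ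

/-- `c^* δ`. -/
def pull {C' C A : B} (c : C' ⟶ C) (δ : S.Ext C A) : S.Ext C' A :=
  (S.E.map c.op).app A δ

lemma pull_id {C A : B} (δ : S.Ext C A) : pull (𝟙 C) δ = δ := by simp [pull]

lemma pull_comp {C'' C' C A : B} (c' : C'' ⟶ C') (c : C' ⟶ C) (δ : S.Ext C A) :
    pull (c' ≫ c) δ = pull c' (pull c δ) := by simp [pull]

lemma pull_add {C' C A : B} (c c' : C' ⟶ C) (δ : S.Ext C A) :
    pull (c + c') δ = pull c δ + pull c' δ := by
  have := S.additive_left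
  simp [pull]

lemma pull_of_eq_zero {C' C A : B} (δ : S.Ext C A) : pull (0 : C' ⟶ C) δ = 0 := by
  have := S.additive_left
  simp [pull]

lemma pull_zero {C' C A : B} (c : C' ⟶ C) : pull c (0 : S.Ext C A) = 0 := by simp [pull]

/-- The sequence `A ⟶ X ⟶ C` realizes `δ`; in other words, it forms an `E`-triangle with `δ`. -/
def Realizes {A X C : B} (x : A ⟶ X) (y : X ⟶ C) (δ : S.Ext C A) : Prop :=
  S.s δ = Quotient.mk (ExtSequence.setoid A C) ⟨X, x, y⟩

/-- The direct sum `δ ⊕ δ'`, the element of `E(C ⊞ C', A ⊞ A')` with components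
`(δ, 0, 0, δ')`. -/
noncomputable def extSum [HasBinaryBiproducts B] {A C A' C' : B}
    (δ : S.Ext C A) (δ' : S.Ext C' A') : S.Ext (C ⊞ C') (A ⊞ A') :=
  pull (S := S) biprod.fst (push (S := S) biprod.inl δ) +
    pull (S := S) biprod.snd (push (S := S) biprod.inr δ')

end Basic

variable [HasBinaryBiproducts B]

/-- `(B, E, s)` is an extriangulated category (the bifunctor `E` is additive by definition). -/
class IsExtriangulated (S : ExtStructure.{w} B) : Prop where
  /-- `s` is a realization of `E`. -/
  realize_map : ∀ {A X C A' X' C' : B} {x : A ⟶ X} {y : X ⟶ C} {δ : S.Ext C A}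
    {x' : A' ⟶ X'} {y' : X' ⟶ C'} {δ' : S.Ext C' A'} (a : A ⟶ A') (c : C ⟶ C'),
    Realizes x y δ → Realizes x' y' δ' → push a δ = pull c δ' →
      ∃ b : X ⟶ X', x ≫ b = a ≫ x' ∧ y ≫ c = b ≫ y'
  /-- The split extension is realized by the split sequence. -/
  realize_zero : ∀ A C : B,
    Realizes (S := S) (biprod.inl : A ⟶ A ⊞ C) (biprod.snd : A ⊞ C ⟶ C) 0
  /-- `s` is compatible with direct sums. -/
  realize_sum : ∀ {A X C A' X' C' : B} {x : A ⟶ X} {y : X ⟶ C} {δ : S.Ext C A}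
    {x' : A' ⟶ X'} {y' : X' ⟶ C'} {δ' : S.Ext C' A'},
    Realizes x y δ → Realizes x' y' δ' →
      Realizes (biprod.map x x') (biprod.map y y') (extSum δ δ')
  et3 : ∀ {A X C A' X' C' : B} {x : A ⟶ X} {y : X ⟶ C} {δ : S.Ext C A}
    {x' : A' ⟶ X'} {y' : X' ⟶ C'} {δ' : S.Ext C' A'} (a : A ⟶ A') (b : X ⟶ X'),
    Realizes x y δ → Realizes x' y' δ' → x ≫ b = a ≫ x' →
      ∃ c : C ⟶ C', push a δ = pull c δ' ∧ y ≫ c = b ≫ y'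
  et3_op : ∀ {A X C A' X' C' : B} {x : A ⟶ X} {y : X ⟶ C} {δ : S.Ext C A}
    {x' : A' ⟶ X'} {y' : X' ⟶ C'} {δ' : S.Ext C' A'} (b : X ⟶ X') (c : C ⟶ C'),
    Realizes x y δ → Realizes x' y' δ' → y ≫ c = b ≫ y' →
      ∃ a : A ⟶ A', push a δ = pull c δ' ∧ x ≫ b = a ≫ x'
  et4 : ∀ {A X D Y F : B} {f : A ⟶ X} {f' : X ⟶ D} {g : X ⟶ Y} {g' : Y ⟶ F}
    {δ : S.Ext D A} {δ' : S.Ext F X}, Realizes f f' δ → Realizes g g' δ' →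
      ∃ (Z : B) (h' : Y ⟶ Z) (d : D ⟶ Z) (e : Z ⟶ F) (δ'' : S.Ext Z A),
        Realizes (f ≫ g) h' δ'' ∧ f' ≫ d = g ≫ h' ∧ g' = h' ≫ e ∧
        Realizes d e (push f' δ') ∧ pull d δ'' = δ ∧ push f δ'' = pull e δ'
  et4_op : ∀ {A X D Y F : B} {f' : D ⟶ X} {f : X ⟶ A} {g' : F ⟶ Y} {g : Y ⟶ X}
    {δ : S.Ext A D} {δ' : S.Ext X F}, Realizes f' f δ → Realizes g' g δ' →
      ∃ (Z : B) (h' : Z ⟶ Y) (d : Z ⟶ D) (e : F ⟶ Z) (δ'' : S.Ext A Z),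
        Realizes h' (g ≫ f) δ'' ∧ d ≫ f' = h' ≫ g ∧ g' = e ≫ h' ∧
        Realizes e d (pull f' δ') ∧ push d δ'' = δ ∧ pull f δ'' = push e δ'

variable (S : ExtStructure.{w} B)

/-! ### Conflations, projectives and injectives -/

section Conflations

/-- A conflation is a sequence that realizes some extension. -/
def IsConflation {A X C : B} (x : A ⟶ X) (y : X ⟶ C) : Prop :=
  ∃ δ : S.Ext C A, Realizes x y δ

/-- The objects `X` that admit a conflation `D₁ ⟶ D₂ ⟶ X` with `D₁ ∈ 𝒟₁`, `D₂ ∈ 𝒟₂`. -/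
def Cone (𝒟₁ 𝒟₂ : ObjectProperty B) : ObjectProperty B := fun X =>
  ∃ (D₁ D₂ : B) (x : D₁ ⟶ D₂) (y : D₂ ⟶ X), 𝒟₁ D₁ ∧ 𝒟₂ D₂ ∧ S.IsConflation x y

/-- The objects `X` that admit a conflation `X ⟶ D₁ ⟶ D₂` with `D₁ ∈ 𝒟₁`, `D₂ ∈ 𝒟₂`. -/
def CoCone (𝒟₁ 𝒟₂ : ObjectProperty B) : ObjectProperty B := fun X =>
  ∃ (D₁ D₂ : B) (x : X ⟶ D₁) (y : D₁ ⟶ D₂), 𝒟₁ D₁ ∧ 𝒟₂ D₂ ∧ S.IsConflation x y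

/-- The projective objects: `E(P, X) = 0` for all `X`. -/
def Proj : ObjectProperty B := fun P => ∀ (X : B) (δ : S.Ext P X), δ = 0

/-- The injective objects: `E(X, I) = 0` for all `X`. -/
def Inj : ObjectProperty B := fun I => ∀ (X : B) (δ : S.Ext X I), δ = 0

/-- Every object `X` admits a deflation `P ⟶ X` from a projective object. -/
class EnoughProj : Prop where
  out : ∀ X : B, ∃ (K P : B) (x : K ⟶ P) (y : P ⟶ X), S.Proj P ∧ S.IsConflation x y

/-- Every object `X` admits an inflation `X ⟶ I` to an injective object. -/
class EnoughInj : Prop where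
  out : ∀ X : B, ∃ (Z I : B) (x : X ⟶ I) (y : I ⟶ Z), S.Inj I ∧ S.IsConflation x y

/-- The projective objects form an additive subcategory. -/
instance proj_isAdditiveSubcategory : IsAdditiveSubcategory S.Proj where
  zero := by
    intro P hP X δ
    rw [← pull_id δ, hP.eq_of_src (𝟙 P) 0, pull_of_eq_zero]
  biprod := by
    intro P Q hP hQ X δ
    rw [← pull_id δ, ← biprod.total, pull_add, pull_comp, pull_comp,
      hP X (pull biprod.inl δ), hQ X (pull biprod.inr δ), pull_zero, pull_zero, add_zero]
  iso := by
    intro P Q e hP X δ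
    rw [← pull_id δ, ← e.inv_hom_id, pull_comp, hP X (pull e.hom δ), pull_zero]

end Conflations

/-! ### Cotorsion pairs and their hearts -/

/-- `(U, V)` is a (complete) cotorsion pair. -/
structure IsCotorsionPair (U V : ObjectProperty B) : Prop where
  additive_left : IsAdditiveSubcategory U
  additive_right : IsAdditiveSubcategory V
  summands_left : ClosedUnderSummands U
  summands_right : ClosedUnderSummands V
  ext_eq_zero : ∀ X Y : B, U X → V Y → ∀ δ : S.Ext X Y, δ = 0
  cone : ∀ X : B, S.Cone V U X
  cocone : ∀ X : B, S.CoCone V U X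

section Heart

variable (U V : ObjectProperty B)

/-- `B⁺ = Cone(V, W)` for the core `W = U ∩ V`. -/
def plus : ObjectProperty B := S.Cone V (U ⊓ V)

/-- `B⁻ = CoCone(W, U)` for the core `W = U ∩ V`. -/
def minus : ObjectProperty B := S.CoCone (U ⊓ V) U

/-- The heart `(B⁺ ∩ B⁻) / W` of `(U, V)`. -/
abbrev Heart : Type u := SubQuotient (S.plus U V ⊓ S.minus U V) (U ⊓ V)

/-- `H : B ⥤ Heart` is the functor associated to the cotorsion pair `(U, V)`, that is
`H ≅ σ⁻ ∘ σ⁺ ∘ π`, where `π : B ⥤ B / W` is the quotient functor, `σ⁺ : B / W ⥤ B⁺ / W` is the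
reflection (the left adjoint of the inclusion) and `σ⁻ : B / W ⥤ B⁻ / W` is the coreflection
(the right adjoint of the inclusion). This determines `H` up to isomorphism. -/
def IsHeartFunctor (H : B ⥤ S.Heart U V) : Prop :=
  ∃ (σp : AddQuotient (U ⊓ V) ⥤ SubQuotient (S.plus U V) (U ⊓ V))
    (σm : AddQuotient (U ⊓ V) ⥤ SubQuotient (S.minus U V) (U ⊓ V)),
    Nonempty (σp ⊣ subQuotientIncl (S.plus U V) (U ⊓ V)) ∧
    Nonempty (subQuotientIncl (S.minus U V) (U ⊓ V) ⊣ σm) ∧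
    Nonempty (H ⋙ subQuotientIncl (S.plus U V ⊓ S.minus U V) (U ⊓ V) ≅
      toAddQuotient (U ⊓ V) ⋙ σp ⋙ subQuotientIncl (S.plus U V) (U ⊓ V) ⋙
        σm ⋙ subQuotientIncl (S.minus U V) (U ⊓ V))

end Heart

/-- The cotorsion pairs `(U, V)` and `(U', V')` are heart-equivalent: the associated functors
`H` and `H'` to the hearts exist, and there is an equivalence `e` of the hearts with
`e ∘ H ≅ H'`. -/
def HeartEquivalent (U V U' V' : ObjectProperty B) : Prop :=
  (∃ H : B ⥤ S.Heart U V, S.IsHeartFunctor U V H) ∧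
  (∃ H' : B ⥤ S.Heart U' V', S.IsHeartFunctor U' V' H') ∧
  ∃ e : S.Heart U V ≌ S.Heart U' V',
    ∀ (H : B ⥤ S.Heart U V) (H' : B ⥤ S.Heart U' V'),
      S.IsHeartFunctor U V H → S.IsHeartFunctor U' V' H' → Nonempty (H ⋙ e.functor ≅ H')

/-! ### Higher extensions and cluster tilting subcategories -/

/-- The `i`-th cosyzygy `Σ^i 𝒟` of a subcategory. -/
def cosyzygy (𝒟 : ObjectProperty B) : ℕ → ObjectProperty B
  | 0 => 𝒟
  | i + 1 => S.Cone (cosyzygy 𝒟 i) S.Inj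

section HigherExt

variable [S.EnoughInj]

/-- A chosen cosyzygy `ΣX` of an object, the third term of a conflation `X ⟶ I ⟶ ΣX` with `I`
injective. -/
noncomputable def sigma (X : B) : B := (EnoughInj.out (S := S) X).choose

/-- The iterated cosyzygy `Σ^i X` of an object. -/
noncomputable def sigmaIter (X : B) : ℕ → B
  | 0 => X
  | i + 1 => S.sigma (sigmaIter X i)

/-- The higher extension group `E^i(X, Y) = E(X, Σ^(i-1) Y)`, for `i ≥ 1`. -/
abbrev HExt (i : ℕ) (X Y : B) : Type w := S.Ext X (S.sigmaIter Y (i - 1))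

/-- `M` is an `n`-cluster tilting subcategory. -/
structure IsClusterTilting (n : ℕ) (M : ObjectProperty B) : Prop where
  contravariantly_finite : ∀ X : B, ∃ (Y : B) (f : Y ⟶ X), M Y ∧
    ∀ (Z : B) (g : Z ⟶ X), M Z → ∃ h : Z ⟶ Y, h ≫ f = g
  covariantly_finite : ∀ X : B, ∃ (Y : B) (f : X ⟶ Y), M Y ∧
    ∀ (Z : B) (g : X ⟶ Z), M Z → ∃ h : Y ⟶ Z, f ≫ h = g
  mem_iff_left : ∀ X : B, M X ↔
    ∀ i : ℕ, 1 ≤ i → i ≤ n - 1 → ∀ Y : B, M Y → ∀ δ : S.HExt i X Y, δ = 0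
  mem_iff_right : ∀ X : B, M X ↔
    ∀ i : ℕ, 1 ≤ i → i ≤ n - 1 → ∀ Y : B, M Y → ∀ δ : S.HExt i Y X, δ = 0

end HigherExt

section Tower

variable (M : ObjectProperty B)

/-- `coneIter M k` is `M_(k+1)`. -/
def coneIter : ℕ → ObjectProperty B
  | 0 => M
  | k + 1 => S.Cone (coneIter k) M

/-- The subcategories `M_ℓ` for `ℓ ≥ 1`: `M_1 = M` and `M_ℓ = Cone(M_(ℓ-1), M)` for `ℓ > 1`. -/
def MSub (ℓ : ℕ) : ObjectProperty B := S.coneIter M (ℓ - 1)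

/-- The subcategories `Y_ℓ = Σ^(ℓ-1) M_(n-ℓ)` for `1 ≤ ℓ ≤ n - 1`. -/
def YSub (n ℓ : ℕ) : ObjectProperty B := S.cosyzygy (S.MSub M (n - ℓ)) (ℓ - 1)

end Tower

end ExtStructure

namespace ExtStructure

open ZeroObject

/-! ### Exact sequences attached to a conflation -/

set_option linter.unusedSectionVars false

section PushPull

variable {B : Type u} [Category.{v} B] [Preadditive B] {S : ExtStructure.{w} B}

/-! The functor `X ↦ E(-, X)` from `B` to `mod (M / P)` does not depend on `ℓ`, and every associated
functor agrees with it up to an equivalence of the heart with `mod (M / P)`. This gives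
heart-equivalence and the description of the hearts at once.

What is needed of a cotorsion pair `(U, V)` is isolated in `IsResolvedBy`: `M ⊆ U`, `E(M, U) = 0`,
and every object of `U` is the end of a conflation `K ⟶ N ⟶ X` with `N ∈ M`, `K ∈ U`. Then `E(-, X)`
kills the core `W`. It also inverts the unit of the reflection onto `B⁺` and the counit of the
coreflection onto `B⁻` (`extIso_plus`, `extIso_minus`), so composing the associated functor with
`E(-, X)` on the heart returns `E(-, X)` on `B`. On the heart it is full and faithful because an
object of `B⁻` has a universal extension by an object of `M` with middle term in `U`, and morphisms
from `U` to `B⁺` factor through `W`. It is dense because a morphism `N₁ ⟶ N₀` of `M`, made a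
deflation by adding a projective, has a kernel `X` with `E(-, X)` its cokernel
(`exists_extModule_iso`).

The pairs themselves rest on `coneIter_iff`: `M_ℓ` consists of the `X` with `E^i(M, X) = 0` for `1 ≤
i ≤ n - ℓ`, so that `M_n = B`. A repeated pushout shows `M_(ℓ+m) ⊆ Cone(Σ^(ℓ-1) M_m, M_ℓ)`
(`cone_of_coneIter`), and `ℓ + m = n` yields one approximation sequence. A pullback along an
injective cosyzygy yields the other. Closure of `Y_ℓ` under summands follows from
`cosyzygy_iff_orth`, which identifies it with the right `E`-orthogonal of `M_ℓ`. -/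

lemma push_id {C A : B} (δ : S.Ext C A) : push (𝟙 A) δ = δ := by simp [push]

lemma push_comp {C A A' A'' : B} (a : A ⟶ A') (a' : A' ⟶ A'') (δ : S.Ext C A) :
    push (a ≫ a') δ = push a' (push a δ) := by simp [push]

lemma push_add {C A A' : B} (a a' : A ⟶ A') (δ : S.Ext C A) :
    push (a + a') δ = push a δ + push a' δ := by
  have := S.additive_right (op C)
  simp [push]

lemma push_of_eq_zero {C A A' : B} (δ : S.Ext C A) : push (0 : A ⟶ A') δ = 0 := by
  have := S.additive_right (op C)
  simp [push]

lemma push_zero {C A A' : B} (a : A ⟶ A') : push a (0 : S.Ext C A) = 0 := by simp [push]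

lemma push_map_add {C A A' : B} (a : A ⟶ A') (δ δ' : S.Ext C A) :
    push a (δ + δ') = push a δ + push a δ' := by simp [push]

lemma push_map_sub {C A A' : B} (a : A ⟶ A') (δ δ' : S.Ext C A) :
    push a (δ - δ') = push a δ - push a δ' := by simp [push]

lemma pull_map_add {C C' A : B} (c : C' ⟶ C) (δ δ' : S.Ext C A) :
    pull c (δ + δ') = pull c δ + pull c δ' := by simp [pull]

lemma pull_sub {C C' A : B} (c c' : C' ⟶ C) (δ : S.Ext C A) :
    pull (c - c') δ = pull c δ - pull c' δ := by
  have := S.additive_left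
  simp [pull]

lemma pull_map_sub {C C' A : B} (c : C' ⟶ C) (δ δ' : S.Ext C A) :
    pull c (δ - δ') = pull c δ - pull c δ' := by simp [pull]

lemma push_sub {C A A' : B} (a a' : A ⟶ A') (δ : S.Ext C A) :
    push (a - a') δ = push a δ - push a' δ := by
  have := S.additive_right (op C)
  simp [push]

lemma pull_push {C C' A A' : B} (c : C' ⟶ C) (a : A ⟶ A') (δ : S.Ext C A) :
    pull c (push a δ) = push a (pull c δ) := by
  simp [push, pull]

lemma exists_realizes {C A : B} (δ : S.Ext C A) :
    ∃ (X : B) (x : A ⟶ X) (y : X ⟶ C), Realizes x y δ := by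
  obtain ⟨⟨X, x, y⟩, h⟩ := _root_.Quotient.exists_rep (S.s δ)
  exact ⟨X, x, y, h.symm⟩

lemma Realizes.of_iso {A X X' C : B} {x : A ⟶ X} {y : X ⟶ C} {δ : S.Ext C A}
    (h : Realizes x y δ) (e : X ≅ X') {x' : A ⟶ X'} {y' : X' ⟶ C} (hx : x ≫ e.hom = x')
    (hy : e.hom ≫ y' = y) : Realizes x' y' δ :=
  h.trans (_root_.Quotient.sound ⟨e, hx, hy⟩)

lemma Realizes.exists_iso {A X X' C : B} {x : A ⟶ X} {y : X ⟶ C} {δ : S.Ext C A}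
    {x' : A ⟶ X'} {y' : X' ⟶ C} (h : Realizes x y δ) (h' : Realizes x' y' δ) :
    ∃ e : X ≅ X', x ≫ e.hom = x' ∧ e.hom ≫ y' = y :=
  _root_.Quotient.exact ((show S.s δ = _ from h).symm.trans h')

end PushPull

section Exact

variable {B : Type u} [Category.{v} B] [Preadditive B] [HasZeroObject B] [HasBinaryBiproducts B]
  {S : ExtStructure.{w} B} [S.IsExtriangulated]

variable (S) in
lemma realizes_id_zero (A : B) : Realizes (S := S) (𝟙 A) (0 : A ⟶ 0) 0 := by
  refine (IsExtriangulated.realize_zero (S := S) A 0).of_iso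
    ⟨biprod.fst, biprod.inl, ?_, by simp⟩ (by simp) ((isZero_zero B).eq_of_tgt _ _)
  ext; simp

variable (S) in
lemma realizes_zero_id (C : B) : Realizes (S := S) (0 : 0 ⟶ C) (𝟙 C) 0 := by
  refine (IsExtriangulated.realize_zero (S := S) 0 C).of_iso
    ⟨biprod.snd, biprod.inr, ?_, by simp⟩ ((isZero_zero B).eq_of_src _ _) (by simp)
  ext; simp

variable {A X C : B} {x : A ⟶ X} {y : X ⟶ C} {δ : S.Ext C A}

lemma Realizes.comp_eq_zero (h : Realizes x y δ) : x ≫ y = 0 := by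
  obtain ⟨b, h₁, h₂⟩ := IsExtriangulated.realize_map (𝟙 A) (0 : (0 : B) ⟶ C)
    (realizes_id_zero S A) h (by rw [push_zero, pull_of_eq_zero])
  simp only [Category.id_comp] at h₁
  rw [← h₁, ← h₂, zero_comp]

lemma Realizes.pull_eq_zero (h : Realizes x y δ) : pull y δ = 0 := by
  obtain ⟨a, h₁, -⟩ := IsExtriangulated.et3_op (𝟙 X) y (realizes_zero_id S X) h rfl
  rw [← h₁, push_zero]

/-- Comparison with the split sequence `Z ⟶ Z ⊞ C ⟶ C`: once `f_* δ = 0`, a morphism of realizations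
`X ⟶ Z ⊞ C` exists, and its first component extends `f`. -/
lemma Realizes.exists_extension (h : Realizes x y δ) {Z : B} (f : A ⟶ Z) (hf : push f δ = 0) :
    ∃ g : X ⟶ Z, x ≫ g = f := by
  obtain ⟨b, h₁, -⟩ := IsExtriangulated.realize_map f (𝟙 C) h
    (IsExtriangulated.realize_zero (S := S) Z C) (by rw [hf, pull_zero])
  exact ⟨b ≫ biprod.fst, by rw [← Category.assoc, h₁]; simp⟩

lemma Realizes.exists_lift (h : Realizes x y δ) {Z : B} (f : Z ⟶ C) (hf : pull f δ = 0) :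
    ∃ g : Z ⟶ X, g ≫ y = f := by
  obtain ⟨b, -, h₂⟩ := IsExtriangulated.realize_map (𝟙 A) f
    (IsExtriangulated.realize_zero (S := S) A Z) h (by rw [hf, push_zero])
  exact ⟨biprod.inr ≫ b, by rw [Category.assoc, ← h₂]; simp⟩

lemma Realizes.exists_desc (h : Realizes x y δ) {Z : B} (g : X ⟶ Z) (hg : x ≫ g = 0) :
    ∃ k : C ⟶ Z, y ≫ k = g := by
  obtain ⟨c, -, h₂⟩ := IsExtriangulated.et3 (0 : A ⟶ 0) g h (realizes_zero_id S Z) (by simp [hg])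
  exact ⟨c, by simpa using h₂⟩

lemma Realizes.exists_lift_kernel (h : Realizes x y δ) {Z : B} (g : Z ⟶ X) (hg : g ≫ y = 0) :
    ∃ k : Z ⟶ A, k ≫ x = g := by
  obtain ⟨a, -, h₂⟩ := IsExtriangulated.et3_op g (0 : 0 ⟶ C) (realizes_id_zero S Z) h (by simp [hg])
  exact ⟨a, by simpa using h₂.symm⟩

lemma Realizes.exists_pull_eq (h : Realizes x y δ) {Z : B} (ε : S.Ext Z A) (hε : push x ε = 0) :
    ∃ c : Z ⟶ C, pull c δ = ε := by
  obtain ⟨Y, i, p, hY⟩ := exists_realizes ε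
  obtain ⟨b, hb⟩ := hY.exists_extension x hε
  obtain ⟨c, h₁, -⟩ := IsExtriangulated.et3 (𝟙 A) b hY h (by simpa using hb)
  exact ⟨c, by rw [← h₁, push_id]⟩

lemma Realizes.exists_push_eq (h : Realizes x y δ) {Z : B} (ε : S.Ext C Z) (hε : pull y ε = 0) :
    ∃ a : A ⟶ Z, push a δ = ε := by
  obtain ⟨Y, i, p, hY⟩ := exists_realizes ε
  obtain ⟨b, hb⟩ := hY.exists_lift y hε
  obtain ⟨a, h₁, -⟩ := IsExtriangulated.et3_op b (𝟙 C) h hY (by simpa using hb.symm)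
  exact ⟨a, by rw [h₁, pull_id]⟩

/-- Apply (ET4) to the conflation and a realization of `ε`. The resulting conflation `C ⟶ Q ⟶ Z` has
class `y_* ε = 0`, and pulling the composite extension back along a section of `Q ⟶ Z` gives the
preimage. -/
lemma Realizes.exists_push_left (h : Realizes x y δ) {Z : B} (ε : S.Ext Z X) (hε : push y ε = 0) :
    ∃ ε' : S.Ext Z A, push x ε' = ε := by
  obtain ⟨Y, g, g', hY⟩ := exists_realizes ε
  obtain ⟨Q, h', d, e, δ'', -, -, -, h₄, -, h₆⟩ := IsExtriangulated.et4 h hY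
  obtain ⟨s, hs⟩ := h₄.exists_lift (𝟙 Z) (by rw [hε, pull_zero])
  exact ⟨pull s δ'', by rw [← pull_push, h₆, ← pull_comp, hs, pull_id]⟩

lemma Realizes.exists_pull_right (h : Realizes x y δ) {Z : B} (ε : S.Ext X Z)
    (hε : pull x ε = 0) : ∃ ε' : S.Ext C Z, pull y ε' = ε := by
  obtain ⟨Y, g', g, hY⟩ := exists_realizes ε
  obtain ⟨Q, h', d, e, δ'', -, -, -, h₄, -, h₆⟩ := IsExtriangulated.et4_op h hY
  obtain ⟨s, hs⟩ := h₄.exists_extension (𝟙 Z) (by rw [hε, push_zero])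
  exact ⟨push s δ'', by rw [pull_push, h₆, ← push_comp, hs, push_id]⟩

/-! ### Split conflations, pushouts and pullbacks of conflations -/

lemma Realizes.exists_iso_biprod {x : A ⟶ X} {y : X ⟶ C} (h : Realizes (S := S) x y 0) :
    ∃ e : X ≅ A ⊞ C, x ≫ e.hom = biprod.inl ∧ e.hom ≫ biprod.snd = y :=
  h.exists_iso (IsExtriangulated.realize_zero A C)

/-- A split sequence realizes the zero extension. -/
lemma realizes_split {A C Z : B} (d : A ⟶ Z) (e : Z ⟶ C) (r : Z ⟶ A) (s : C ⟶ Z)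
    (h₁ : d ≫ r = 𝟙 A) (h₂ : s ≫ e = 𝟙 C) (h₃ : d ≫ e = 0) (h₄ : s ≫ r = 0)
    (h₅ : r ≫ d + e ≫ s = 𝟙 Z) : Realizes (S := S) d e 0 := by
  refine (IsExtriangulated.realize_zero (S := S) A C).of_iso
    ⟨biprod.desc d s, biprod.lift r e, ?_, by simpa using h₅⟩ (by simp) ?_
  · ext <;> simp [h₁, h₂, h₃, h₄]
  · ext <;> simp [h₂, h₃]

lemma Realizes.exists_splitting {d : A ⟶ X} {e : X ⟶ C} (h : Realizes (S := S) d e 0)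
    (s : C ⟶ X) (hs : s ≫ e = 𝟙 C) :
    ∃ r : X ⟶ A, d ≫ r = 𝟙 A ∧ s ≫ r = 0 ∧ r ≫ d + e ≫ s = 𝟙 X := by
  obtain ⟨r, hr⟩ := h.exists_lift_kernel (𝟙 X - e ≫ s) (by simp [hs])
  obtain ⟨r₀, hr₀⟩ := h.exists_extension (𝟙 A) (by rw [push_zero])
  have hd : d ≫ e = 0 := h.comp_eq_zero
  have mono : ∀ {T : B} (f g : T ⟶ A), f ≫ d = g ≫ d → f = g := fun f g hfg => by
    simpa [hr₀] using congrArg (· ≫ r₀) hfg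
  refine ⟨r, mono _ _ ?_, mono _ _ ?_, by rw [hr]; abel⟩
  · simp [hr, reassoc_of% hd]
  · simp [hr, reassoc_of% hs]

/-- `b - 1` factors through `x` and is killed by `x`, hence squares to zero, and `2 - b` is inverse
to `b`. -/
lemma Realizes.isIso_of_endo (h : Realizes x y δ) (b : X ⟶ X) (h₁ : x ≫ b = x) (h₂ : b ≫ y = y) :
    IsIso b := by
  obtain ⟨m, hm⟩ := h.exists_lift_kernel (b - 𝟙 X) (by simp [h₂])
  have hn : (b - 𝟙 X) ≫ (b - 𝟙 X) = 0 := by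
    conv_lhs => rw [← hm]
    rw [Category.assoc, hm, Preadditive.comp_sub, h₁, Category.comp_id, sub_self, comp_zero]
  simp only [Preadditive.comp_sub, Preadditive.sub_comp, Category.id_comp, Category.comp_id] at hn
  have hb : b ≫ b = b + b - 𝟙 X := by
    rw [← sub_eq_zero, ← hn]; abel
  refine ⟨𝟙 X + 𝟙 X - b, ?_, ?_⟩ <;>
    simp [hb]

lemma Realizes.exists_splitting_of_retraction {d : A ⟶ X} {e : X ⟶ C}
    (h : Realizes (S := S) d e 0) (r : X ⟶ A) (hr : d ≫ r = 𝟙 A) :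
    ∃ s : C ⟶ X, s ≫ e = 𝟙 C ∧ s ≫ r = 0 ∧ r ≫ d + e ≫ s = 𝟙 X := by
  obtain ⟨s, hs⟩ := h.exists_desc (𝟙 X - r ≫ d) (by simp [reassoc_of% hr])
  obtain ⟨s₀, hs₀⟩ := h.exists_lift (𝟙 C) (by rw [pull_zero])
  have hd : d ≫ e = 0 := h.comp_eq_zero
  have epi : ∀ {T : B} (f g : C ⟶ T), e ≫ f = e ≫ g → f = g := fun f g hfg => by
    simpa [reassoc_of% hs₀] using congrArg (s₀ ≫ ·) hfg
  refine ⟨s, epi _ _ ?_, epi _ _ ?_, by rw [hs]; abel⟩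
  · simp [reassoc_of% hs, hd]
  · simp [reassoc_of% hs, hr]

/-- The first term of a conflation may be replaced by an isomorphic object. -/
lemma Realizes.of_iso_left (h : Realizes x y δ) {A' : B} (φ : A ≅ A') :
    Realizes (φ.inv ≫ x) y (push φ.hom δ) := by
  obtain ⟨R, j, l, hR⟩ := exists_realizes (push φ.hom δ)
  obtain ⟨b, hb₁, hb₂⟩ := IsExtriangulated.realize_map φ.hom (𝟙 C) h hR (by rw [pull_id])
  obtain ⟨b', hb₁', hb₂'⟩ := IsExtriangulated.realize_map φ.inv (𝟙 C) hR h
    (by rw [pull_id, ← push_comp, φ.hom_inv_id, push_id])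
  rw [Category.comp_id] at hb₂ hb₂'
  have i₁ : IsIso (b ≫ b') := h.isIso_of_endo _ (by rw [reassoc_of% hb₁, hb₁']; simp)
    (by rw [Category.assoc, ← hb₂', hb₂])
  have i₂ : IsIso (b' ≫ b) := hR.isIso_of_endo _ (by rw [reassoc_of% hb₁', hb₁]; simp)
    (by rw [Category.assoc, ← hb₂, hb₂'])
  have i₃ : IsIso b := by
    have e₁ : IsSplitEpi b := ⟨⟨inv (b' ≫ b) ≫ b', by simp⟩⟩
    have e₂ : IsSplitMono b := ⟨⟨b' ≫ inv (b ≫ b'), by simp [← Category.assoc]⟩⟩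
    exact isIso_of_epi_of_isSplitMono b
  exact hR.of_iso (asIso b).symm (by
    rw [Iso.symm_hom, asIso_inv, Iso.eq_inv_comp, ← reassoc_of% hb₁]; simp) (by simp [hb₂])

/-- (ET4) for `x₁` followed by a realization of `x₁_* δ₂` produces a conflation `C₁ ⟶ Z ⟶ C₂` of
class `y₁_* x₁_* δ₂ = 0`. Exchanging the two summands of `Z` and applying the dual axiom then
produces the second conflation. -/
lemma Realizes.exists_pushout {A B₁ C₁ B₂ C₂ : B} {x₁ : A ⟶ B₁} {y₁ : B₁ ⟶ C₁} {δ₁ : S.Ext C₁ A}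
    {x₂ : A ⟶ B₂} {y₂ : B₂ ⟶ C₂} {δ₂ : S.Ext C₂ A} (h₁ : Realizes x₁ y₁ δ₁)
    (h₂ : Realizes x₂ y₂ δ₂) :
    ∃ (Q : B) (i₁ : B₁ ⟶ Q) (p₁ : Q ⟶ C₂) (i₂ : B₂ ⟶ Q) (p₂ : Q ⟶ C₁),
      Realizes i₁ p₁ (push x₁ δ₂) ∧ S.IsConflation i₂ p₂ := by
  obtain ⟨Q, i, p, hQ⟩ := exists_realizes (push x₁ δ₂)
  obtain ⟨Z, q, d, e, δ'', hZ, hd, he, hde, hδ₁, hδ₂⟩ := IsExtriangulated.et4 h₁ hQ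
  rw [← push_comp, h₁.comp_eq_zero, push_of_eq_zero] at hde
  obtain ⟨s₀, hs₀⟩ := hde.exists_lift (𝟙 C₂) (by rw [pull_zero])
  -- An arbitrary section `s₀` pulls `δ''` back to `δ₂` only up to an extension killed by `x₁`. Such
  -- an extension is a pullback of `δ₁`, so subtracting `c ≫ d` from `s₀` repairs the section.
  obtain ⟨c, hc⟩ := h₁.exists_pull_eq (pull s₀ δ'' - δ₂) (by
    rw [push_map_sub, ← pull_push, hδ₂, ← pull_comp, hs₀, pull_id, sub_self])
  have hde' := hde.comp_eq_zero
  have hs : (s₀ - c ≫ d) ≫ e = 𝟙 C₂ := by simp [hs₀, hde']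
  have hs' : pull (s₀ - c ≫ d) δ'' = δ₂ := by
    rw [pull_sub, pull_comp, hδ₁, hc, sub_sub_cancel]
  obtain ⟨r, hr₁, hr₂, hr₃⟩ := hde.exists_splitting _ hs
  have hsplit : Realizes (S := S) (s₀ - c ≫ d) r 0 :=
    realizes_split _ r e d hs hr₁ hr₂ hde' (by rw [add_comm]; exact hr₃)
  -- The kernel `T` of `Q ⟶ C₁` is an extension of `C₂` by `A` with class `δ₂`, hence isomorphic to
  -- `B₂`.
  obtain ⟨T, t, m, k, θ, hT, -, -, hkm, -, -⟩ := IsExtriangulated.et4_op hsplit hZ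
  rw [hs'] at hkm
  obtain ⟨φ, hφ₁, hφ₂⟩ := hkm.exists_iso h₂
  exact ⟨Q, i, p, φ.inv ≫ t, q ≫ r, hQ, _, hT.of_iso_left φ⟩

/-- The third term of a conflation may be replaced by an isomorphic object. -/
lemma Realizes.of_iso_right (h : Realizes x y δ) {C' : B} (φ : C ≅ C') :
    Realizes x (y ≫ φ.hom) (pull φ.inv δ) := by
  obtain ⟨R, j, l, hR⟩ := exists_realizes (pull φ.inv δ)
  obtain ⟨b, hb₁, hb₂⟩ := IsExtriangulated.realize_map (𝟙 A) φ.hom h hR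
    (by rw [push_id, ← pull_comp, φ.hom_inv_id, pull_id])
  obtain ⟨b', hb₁', hb₂'⟩ := IsExtriangulated.realize_map (𝟙 A) φ.inv hR h (by rw [push_id])
  rw [Category.id_comp] at hb₁ hb₁'
  have i₁ : IsIso (b ≫ b') := h.isIso_of_endo _ (by rw [reassoc_of% hb₁, hb₁'])
    (by rw [Category.assoc, ← hb₂', ← reassoc_of% hb₂]; simp)
  have i₂ : IsIso (b' ≫ b) := hR.isIso_of_endo _ (by rw [reassoc_of% hb₁', hb₁])
    (by rw [Category.assoc, ← hb₂, ← reassoc_of% hb₂']; simp)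
  have i₃ : IsIso b := by
    have e₁ : IsSplitEpi b := ⟨⟨inv (b' ≫ b) ≫ b', by simp⟩⟩
    have e₂ : IsSplitMono b := ⟨⟨b' ≫ inv (b ≫ b'), by simp [← Category.assoc]⟩⟩
    exact isIso_of_epi_of_isSplitMono b
  exact hR.of_iso (asIso b).symm (by simp [← hb₁]) (by simp [hb₂])

/-- Dual to `Realizes.exists_pushout`; a retraction is corrected instead of a section. -/
lemma Realizes.exists_pullback {A₁ B₁ A₂ B₂ C : B} {x₁ : A₁ ⟶ B₁} {y₁ : B₁ ⟶ C} {δ₁ : S.Ext C A₁}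
    {x₂ : A₂ ⟶ B₂} {y₂ : B₂ ⟶ C} {δ₂ : S.Ext C A₂} (h₁ : Realizes x₁ y₁ δ₁)
    (h₂ : Realizes x₂ y₂ δ₂) :
    ∃ (Q : B) (i₁ : A₁ ⟶ Q) (p₁ : Q ⟶ B₂) (i₂ : A₂ ⟶ Q) (p₂ : Q ⟶ B₁),
      S.IsConflation i₁ p₁ ∧ Realizes i₂ p₂ (pull y₁ δ₂) := by
  obtain ⟨Q, i, p, hQ⟩ := exists_realizes (pull y₁ δ₂)
  obtain ⟨Z, q, d, e, δ'', hZ, hd, he, hde, hδ₁, hδ₂⟩ := IsExtriangulated.et4_op h₁ hQ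
  rw [← pull_comp, h₁.comp_eq_zero, pull_of_eq_zero] at hde
  obtain ⟨r₀, hr₀⟩ := hde.exists_extension (𝟙 A₂) (by rw [push_zero])
  obtain ⟨a, ha⟩ := h₁.exists_push_eq (push r₀ δ'' - δ₂) (by
    rw [pull_map_sub, pull_push, hδ₂, ← push_comp, hr₀, push_id, sub_self])
  have hde' := hde.comp_eq_zero
  have hr : e ≫ (r₀ - d ≫ a) = 𝟙 A₂ := by simp [hr₀, reassoc_of% hde']
  have hr' : push (r₀ - d ≫ a) δ'' = δ₂ := by
    rw [push_sub, push_comp, hδ₁, ha, sub_sub_cancel]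
  obtain ⟨s, hs₁, hs₂, hs₃⟩ := hde.exists_splitting_of_retraction _ hr
  have hsplit : Realizes (S := S) s (r₀ - d ≫ a) 0 :=
    realizes_split _ _ d e hs₁ hr hs₂ hde' (by rw [add_comm]; exact hs₃)
  obtain ⟨T, t, m, k, θ, hT, -, -, hkm, -, -⟩ := IsExtriangulated.et4 hsplit hZ
  rw [hr'] at hkm
  obtain ⟨φ, hφ₁, hφ₂⟩ := hkm.exists_iso h₂
  exact ⟨Q, _, _, i, p, ⟨_, hT.of_iso_right φ⟩, hQ⟩

end Exact

end ExtStructure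

namespace ExtStructure

open ZeroObject

set_option linter.unusedSectionVars false

/-! ### Vanishing of higher extensions -/

section Vanishing

variable {B : Type u} [Category.{v} B] [Preadditive B] [HasZeroObject B] [HasBinaryBiproducts B]
  (S : ExtStructure.{w} B)

/-- The vanishing of `E(X, Y)`. -/
def Orth (X Y : B) : Prop := ∀ δ : S.Ext X Y, δ = 0

variable {S}

lemma Orth.of_retract_right {U X Y : B} (h : S.Orth U Y) (i : X ⟶ Y) (r : Y ⟶ X)
    (hr : i ≫ r = 𝟙 X) : S.Orth U X := fun δ => by
  rw [← push_id δ, ← hr, push_comp, h (push i δ), push_zero]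

lemma Orth.biprod_right {U X Y : B} (h : S.Orth U X) (h' : S.Orth U Y) : S.Orth U (X ⊞ Y) :=
  fun δ => by
  rw [← push_id δ, ← biprod.total, push_add, push_comp, push_comp,
    h (push biprod.fst δ), h' (push biprod.snd δ), push_zero, push_zero, add_zero]

lemma Orth.zero_right {U X : B} (hX : IsZero X) : S.Orth U X := fun δ => by
  rw [← push_id δ, hX.eq_of_src (𝟙 X) 0, push_of_eq_zero]

variable [S.IsExtriangulated]

section

variable {A X C : B} {x : A ⟶ X} {y : X ⟶ C}

lemma IsConflation.orth_mid (h : S.IsConflation x y) {U : B} (hA : S.Orth U A) (hC : S.Orth U C) :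
    S.Orth U X := fun ε => by
  obtain ⟨δ, h⟩ := h
  obtain ⟨ε', rfl⟩ := h.exists_push_left ε (hC _)
  rw [hA ε', push_zero]

lemma IsConflation.orth_mid_left (h : S.IsConflation x y) {U : B} (hA : S.Orth A U)
    (hC : S.Orth C U) : S.Orth X U := fun ε => by
  obtain ⟨δ, h⟩ := h
  obtain ⟨ε', rfl⟩ := h.exists_pull_right ε (hA _)
  rw [hC ε', pull_zero]

/-- Exactness of `E(U, X) ⟶ E(U, C) ⟶ E²(U, A)`, with `E²(U, A)` replaced by `E(K, A)` for a syzygy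
`K` of `U`: an extension in `E(U, C)` is the pushout of `K ⟶ P ⟶ U` along some `K ⟶ C`, and that
morphism lifts to `X`. -/
lemma IsConflation.orth_third (h : S.IsConflation x y) {U P K : B} {k : K ⟶ P} {p : P ⟶ U}
    (h' : S.IsConflation k p) (hP : S.Proj P) (hX : S.Orth U X) (hA : S.Orth K A) :
    S.Orth U C := fun ε => by
  obtain ⟨δ, h⟩ := h
  obtain ⟨κ, h'⟩ := h'
  obtain ⟨f, rfl⟩ := h'.exists_push_eq ε (hP _ _)
  obtain ⟨g, rfl⟩ := h.exists_lift f (hA _)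
  rw [push_comp, hX (push g κ), push_zero]

lemma IsConflation.orth_first (h : S.IsConflation x y) {U P K : B} {k : K ⟶ P} {p : P ⟶ U}
    (h' : S.IsConflation k p) (hP : S.Proj P) (hC : S.Orth U C) (hX : S.Orth K X) :
    S.Orth K A := fun ε => by
  obtain ⟨δ, h⟩ := h
  obtain ⟨κ, h'⟩ := h'
  obtain ⟨f, rfl⟩ := h.exists_pull_eq ε (hX _)
  obtain ⟨g, rfl⟩ := h'.exists_extension f (hC _)
  rw [pull_comp, hP _ (pull g δ), pull_zero]

lemma IsConflation.orth_third_left (h : S.IsConflation x y) {U I Z : B} {i : U ⟶ I} {q : I ⟶ Z}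
    (h' : S.IsConflation i q) (hI : S.Inj I) (hA : S.Orth A U) (hX : S.Orth X Z) :
    S.Orth C Z := fun ε => by
  obtain ⟨δ, h⟩ := h
  obtain ⟨κ, h'⟩ := h'
  obtain ⟨f, rfl⟩ := h.exists_push_eq ε (hX _)
  obtain ⟨g, rfl⟩ := h'.exists_lift f (hA _)
  rw [push_comp, hI _ (push g δ), push_zero]

/-- Dimension shifting. -/
lemma orth_shift {U P K I Z : B} {k : K ⟶ P} {p : P ⟶ U} {i : X ⟶ I} {q : I ⟶ Z}
    (h : S.IsConflation k p) (hP : S.Proj P) (h' : S.IsConflation i q) (hI : S.Inj I) :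
    S.Orth K X ↔ S.Orth U Z :=
  ⟨fun hK => h'.orth_third h hP (hI U) hK, fun hU => h'.orth_first h hP hU (hI K)⟩

end

variable (S)

/-- A chosen syzygy of an object. -/
noncomputable def omega [S.EnoughProj] (X : B) : B := (EnoughProj.out (S := S) X).choose

variable [S.EnoughInj]

/-- The vanishing of `E^(i+1)(X, Y)`. -/
def HOrth (i : ℕ) (X Y : B) : Prop := S.Orth X (S.sigmaIter Y i)

lemma sigma_spec (X : B) : ∃ (I : B) (x : X ⟶ I) (y : I ⟶ S.sigma X), S.Inj I ∧ S.IsConflation x y :=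
  (EnoughInj.out (S := S) X).choose_spec

variable [S.EnoughProj]

lemma omega_spec (X : B) : ∃ (P : B) (x : S.omega X ⟶ P) (y : P ⟶ X), S.Proj P ∧ S.IsConflation x y :=
  (EnoughProj.out (S := S) X).choose_spec

variable {S}

/-- Moving the shift from `Σ^i Y` to `Ω^i X` reduces statements on a conflation in the second
variable to first extensions, with no need to compare cosyzygies of its three terms. -/
lemma hOrth_iff_omega {i : ℕ} {X Y : B} : S.HOrth i X Y ↔ S.Orth (S.omega^[i] X) Y := by
  induction i generalizing X with
  | zero => rfl
  | succ i ih =>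
    obtain ⟨P, k, p, hP, h⟩ := S.omega_spec X
    obtain ⟨I, k', p', hI, h'⟩ := S.sigma_spec (S.sigmaIter Y i)
    rw [Function.iterate_succ_apply, ← ih]
    exact (orth_shift h hP h' hI).symm

lemma HOrth.of_retract_right {i : ℕ} {U X Y : B} (h : S.HOrth i U Y) (j : X ⟶ Y) (r : Y ⟶ X)
    (hr : j ≫ r = 𝟙 X) : S.HOrth i U X :=
  hOrth_iff_omega.2 ((hOrth_iff_omega.1 h).of_retract_right j r hr)

lemma HOrth.biprod_right {i : ℕ} {U X Y : B} (h : S.HOrth i U X) (h' : S.HOrth i U Y) :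
    S.HOrth i U (X ⊞ Y) :=
  hOrth_iff_omega.2 ((hOrth_iff_omega.1 h).biprod_right (hOrth_iff_omega.1 h'))

lemma HOrth.of_inj {i : ℕ} {U I : B} (hI : S.Inj I) : S.HOrth i U I :=
  hOrth_iff_omega.2 (hI _)

lemma HOrth.of_proj {i : ℕ} {P X : B} (hP : S.Proj P) : S.HOrth i P X := hP _

variable {A X C : B} {x : A ⟶ X} {y : X ⟶ C}

lemma IsConflation.hOrth_mid (h : S.IsConflation x y) {i : ℕ} {U : B} (hA : S.HOrth i U A)
    (hC : S.HOrth i U C) : S.HOrth i U X :=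
  hOrth_iff_omega.2 (h.orth_mid (hOrth_iff_omega.1 hA) (hOrth_iff_omega.1 hC))

lemma IsConflation.hOrth_third (h : S.IsConflation x y) {i : ℕ} {U : B} (hX : S.HOrth i U X)
    (hA : S.HOrth (i + 1) U A) : S.HOrth i U C := by
  rw [hOrth_iff_omega] at *
  rw [Function.iterate_succ_apply'] at hA
  obtain ⟨P, k, p, hP, h'⟩ := S.omega_spec (S.omega^[i] U)
  exact h.orth_third h' hP hX hA

lemma IsConflation.hOrth_first (h : S.IsConflation x y) {i : ℕ} {U : B} (hC : S.HOrth i U C)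
    (hX : S.HOrth (i + 1) U X) : S.HOrth (i + 1) U A := by
  rw [hOrth_iff_omega] at *
  rw [Function.iterate_succ_apply'] at *
  obtain ⟨P, k, p, hP, h'⟩ := S.omega_spec (S.omega^[i] U)
  exact h.orth_first h' hP hC hX

lemma IsConflation.hOrth_third_left (h : S.IsConflation x y) {i : ℕ} {U : B}
    (hA : S.HOrth i A U) (hX : S.HOrth (i + 1) X U) : S.HOrth (i + 1) C U := by
  obtain ⟨I, k, p, hI, h'⟩ := S.sigma_spec (S.sigmaIter U i)
  exact h.orth_third_left h' hI hA hX

lemma hOrth_of_cosyzygy {D : ObjectProperty B} {U : B} (i j : ℕ)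
    (hD : ∀ Z, D Z → S.HOrth (i + j) U Z) {X : B} (hX : S.cosyzygy D j X) : S.HOrth i U X := by
  induction j generalizing i X with
  | zero => exact hD X hX
  | succ j ih =>
    obtain ⟨Z, I, a, b, hZ, hI, h⟩ := hX
    exact h.hOrth_third (.of_inj hI) (ih (i + 1) (fun Z hZ => by
      rw [add_right_comm, add_assoc]; exact hD Z hZ) hZ)

end Vanishing

/-! ### Conflations and deflations -/

section Deflations

variable {B : Type u} [Category.{v} B] [Preadditive B] [HasZeroObject B] [HasBinaryBiproducts B]
  {S : ExtStructure.{w} B} [S.IsExtriangulated]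

/-- Two conflations `A ⟶ X ⟶ C` and `K ⟶ Y ⟶ X` give conflations `Z ⟶ Y ⟶ C` and `K ⟶ Z ⟶ A`. -/
lemma IsConflation.comp_deflation {A X C K Y : B} {x : A ⟶ X} {y : X ⟶ C} {k : K ⟶ Y} {p : Y ⟶ X}
    (h : S.IsConflation x y) (h' : S.IsConflation k p) :
    ∃ (Z : B) (z : Z ⟶ Y) (a : K ⟶ Z) (b : Z ⟶ A), S.IsConflation z (p ≫ y) ∧
      S.IsConflation a b := by
  obtain ⟨δ, h⟩ := h
  obtain ⟨δ', h'⟩ := h'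
  obtain ⟨Z, z, d, e, δ'', h₁, -, -, h₂, -⟩ := IsExtriangulated.et4_op h h'
  exact ⟨Z, z, e, d, ⟨_, h₁⟩, ⟨_, h₂⟩⟩

/-- Two conflations `A ⟶ X ⟶ C` and `X ⟶ Y ⟶ L` give conflations `A ⟶ Y ⟶ Z` and `C ⟶ Z ⟶ L`. -/
lemma IsConflation.comp_inflation {A X C L Y : B} {x : A ⟶ X} {y : X ⟶ C} {k : X ⟶ Y} {p : Y ⟶ L}
    (h : S.IsConflation x y) (h' : S.IsConflation k p) :
    ∃ (Z : B) (z : Y ⟶ Z) (a : C ⟶ Z) (b : Z ⟶ L), S.IsConflation (x ≫ k) z ∧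
      S.IsConflation a b := by
  obtain ⟨δ, h⟩ := h
  obtain ⟨δ', h'⟩ := h'
  obtain ⟨Z, z, d, e, δ'', h₁, -, -, h₂, -⟩ := IsExtriangulated.et4 h h'
  exact ⟨Z, z, d, e, ⟨_, h₁⟩, ⟨_, h₂⟩⟩

lemma IsConflation.of_iso {A X X' C : B} {x : A ⟶ X} {y : X ⟶ C} (h : S.IsConflation x y)
    (e : X ≅ X') : S.IsConflation (x ≫ e.hom) (e.inv ≫ y) := by
  obtain ⟨δ, h⟩ := h
  exact ⟨δ, h.of_iso e rfl (by simp)⟩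

lemma IsConflation.biprod_map {A X C A' X' C' : B} {x : A ⟶ X} {y : X ⟶ C} {x' : A' ⟶ X'}
    {y' : X' ⟶ C'} (h : S.IsConflation x y) (h' : S.IsConflation x' y') :
    S.IsConflation (biprod.map x x') (biprod.map y y') := by
  obtain ⟨δ, h⟩ := h
  obtain ⟨δ', h'⟩ := h'
  exact ⟨_, IsExtriangulated.realize_sum h h'⟩

/-- A deflation may be enlarged by an arbitrary morphism. -/
lemma IsConflation.exists_desc_deflation {K P X : B} {k : K ⟶ P} {p : P ⟶ X}
    (h : S.IsConflation k p) {M : B} (f : M ⟶ X) :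
    ∃ (L : B) (l : L ⟶ M ⊞ P), S.IsConflation l (biprod.desc f p) := by
  -- `(f, p)` is the composite of the deflation `1 ⊕ p : M ⊞ P ⟶ M ⊞ X` with the split deflation
  -- `(f, 1) : M ⊞ X ⟶ X`.
  have h₁ : S.IsConflation (biprod.map (0 : 0 ⟶ M) k) (biprod.map (𝟙 M) p) :=
    IsConflation.biprod_map ⟨_, realizes_zero_id S M⟩ h
  have h₂ : S.IsConflation (biprod.lift (𝟙 M) (-f)) (biprod.desc f (𝟙 X)) := by
    refine ⟨0, realizes_split _ _ biprod.fst biprod.inr (by simp) (by simp) (by simp) (by simp) ?_⟩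
    ext <;> simp
  obtain ⟨Z, z, -, -, hz, -⟩ := h₂.comp_deflation h₁
  refine ⟨Z, z, ?_⟩
  convert hz using 1
  ext <;> simp

/-- If `E(C, A) = 0`, then the middle term of a conflation `A ⟶ X ⟶ C` is a biproduct. -/
lemma IsConflation.exists_iso_biprod {A X C : B} {x : A ⟶ X} {y : X ⟶ C} (h : S.IsConflation x y)
    (h' : S.Orth C A) : ∃ e : X ≅ A ⊞ C, x ≫ e.hom = biprod.inl ∧ e.hom ≫ biprod.snd = y := by
  obtain ⟨δ, h⟩ := h
  obtain rfl := h' δ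
  exact h.exists_iso_biprod

end Deflations

/-! ### Cones of additive subcategories -/

section Cones

variable {B : Type u} [Category.{v} B] [Preadditive B] [HasZeroObject B] [HasBinaryBiproducts B]
  {S : ExtStructure.{w} B} [S.IsExtriangulated]

lemma inj_biprod {I J : B} (hI : S.Inj I) (hJ : S.Inj J) : S.Inj (I ⊞ J) := fun X =>
  Orth.biprod_right (hI X) (hJ X)

lemma inj_zero : S.Inj (0 : B) := fun _ => Orth.zero_right (isZero_zero B)

lemma cosyzygy_biprod {D : ObjectProperty B} (hD : ∀ X Y, D X → D Y → D (X ⊞ Y)) (j : ℕ) {X Y : B}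
    (hX : S.cosyzygy D j X) (hY : S.cosyzygy D j Y) : S.cosyzygy D j (X ⊞ Y) := by
  induction j generalizing X Y with
  | zero => exact hD X Y hX hY
  | succ j ih =>
    obtain ⟨Z, I, a, b, hZ, hI, h⟩ := hX
    obtain ⟨Z', I', a', b', hZ', hI', h'⟩ := hY
    exact ⟨_, _, _, _, ih hZ hZ', inj_biprod hI hI', h.biprod_map h'⟩

lemma cosyzygy_of_inj {D : ObjectProperty B} (hD : ∀ I, S.Inj I → D I) (j : ℕ) {I : B}
    (hI : S.Inj I) : S.cosyzygy D j I := by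
  induction j generalizing I with
  | zero => exact hD I hI
  | succ j ih => exact ⟨_, _, _, _, ih inj_zero, hI, _, realizes_zero_id S I⟩

end Cones

end ExtStructure

namespace ExtStructure

open ZeroObject

set_option linter.unusedSectionVars false

/-! ### The cotorsion pairs of a cluster tilting subcategory -/

section ClusterTilting

variable {B : Type u} [Category.{v} B] [Preadditive B] [HasZeroObject B] [HasBinaryBiproducts B]
  {S : ExtStructure.{w} B} [S.IsExtriangulated] [S.EnoughProj] [S.EnoughInj]
  {n : ℕ} {M : ObjectProperty B}

namespace IsClusterTilting

variable (hM : S.IsClusterTilting n M)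
include hM

lemma mem_iff_hOrth_left (X : B) :
    M X ↔ ∀ i, i + 1 < n → ∀ Y, M Y → S.HOrth i X Y := by
  rw [hM.mem_iff_left]
  constructor
  · intro h i hi Y hY
    exact h (i + 1) (by omega) (by omega) Y hY
  · intro h i h₁ h₂ Y hY
    exact h (i - 1) (by omega) Y hY

lemma mem_iff_hOrth_right (X : B) :
    M X ↔ ∀ i, i + 1 < n → ∀ Y, M Y → S.HOrth i Y X := by
  rw [hM.mem_iff_right]
  constructor
  · intro h i hi Y hY
    exact h (i + 1) (by omega) (by omega) Y hY
  · intro h i h₁ h₂ Y hY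
    exact h (i - 1) (by omega) Y hY

lemma mem_of_proj {P : B} (hP : S.Proj P) : M P :=
  (hM.mem_iff_hOrth_left P).2 fun _ _ _ _ => .of_proj hP

lemma mem_of_inj {I : B} (hI : S.Inj I) : M I :=
  (hM.mem_iff_hOrth_right I).2 fun _ _ _ _ => .of_inj hI

lemma mem_biprod {X Y : B} (hX : M X) (hY : M Y) : M (X ⊞ Y) :=
  (hM.mem_iff_hOrth_right _).2 fun i hi Z hZ =>
    ((hM.mem_iff_hOrth_right X).1 hX i hi Z hZ).biprod_right
      ((hM.mem_iff_hOrth_right Y).1 hY i hi Z hZ)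

/-- Every object has a right `M`-approximation that is a deflation. -/
lemma exists_deflation (X : B) : ∃ (K N : B) (k : K ⟶ N) (p : N ⟶ X), M N ∧ S.IsConflation k p ∧
    ∀ (Z : B) (g : Z ⟶ X), M Z → ∃ h : Z ⟶ N, h ≫ p = g := by
  obtain ⟨Y, f, hY, hf⟩ := hM.contravariantly_finite X
  obtain ⟨P, k, p, hP, h⟩ := S.omega_spec X
  obtain ⟨L, l, hl⟩ := h.exists_desc_deflation f
  refine ⟨L, _, l, _, hM.mem_biprod hY (hM.mem_of_proj hP), hl, fun Z g hZ => ?_⟩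
  obtain ⟨h, hh⟩ := hf Z g hZ
  exact ⟨h ≫ biprod.inl, by simp [hh]⟩

/-- Since `E(Y, N) = 0`, every extension of `Y` by `K` comes from a morphism `Y ⟶ X`; that morphism
lifts through the approximation, so the extension vanishes. -/
lemma orth_of_approximation (hn : 2 ≤ n) {K N X : B} {k : K ⟶ N} {p : N ⟶ X} (hN : M N)
    (h : S.IsConflation k p) (hp : ∀ (Z : B) (g : Z ⟶ X), M Z → ∃ h : Z ⟶ N, h ≫ p = g)
    {Y : B} (hY : M Y) : S.Orth Y K := fun ε => by
  obtain ⟨δ, h⟩ := h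
  obtain ⟨c, rfl⟩ := h.exists_pull_eq ε
    ((hM.mem_iff_hOrth_right N).1 hN 0 (by omega) Y hY _)
  obtain ⟨g, rfl⟩ := hp _ c hY
  rw [pull_comp, h.pull_eq_zero, pull_zero]

lemma hOrth_of_approximation (hn : 2 ≤ n) {K N X : B} {k : K ⟶ N} {p : N ⟶ X} (hN : M N)
    (h : S.IsConflation k p) (hp : ∀ (Z : B) (g : Z ⟶ X), M Z → ∃ h : Z ⟶ N, h ≫ p = g)
    {m : ℕ} (hm : m + 1 < n) (hX : ∀ i, i < m → ∀ Y, M Y → S.HOrth i Y X) (i : ℕ) (hi : i ≤ m)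
    {Y : B} (hY : M Y) : S.HOrth i Y K := by
  cases i with
  | zero => exact hM.orth_of_approximation hn hN h hp hY
  | succ i =>
    exact h.hOrth_first (hX i hi Y hY) ((hM.mem_iff_hOrth_right N).1 hN _ (by omega) Y hY)

/-- As `HOrth i` is the vanishing of `E^(i+1)`, this says that `M_(k+1)` is cut out by `E^i(M, X) =
0` for `1 ≤ i ≤ n - 1 - k`. The kernel of a right `M`-approximation gains one degree of vanishing,
which drives the converse. At `k = n - 1` the condition is empty. -/
lemma coneIter_iff (hn : 2 ≤ n) (k : ℕ) (hk : k < n) (X : B) :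
    S.coneIter M k X ↔ ∀ i, i + k + 1 < n → ∀ Y, M Y → S.HOrth i Y X := by
  induction k generalizing X with
  | zero => exact hM.mem_iff_hOrth_right X
  | succ k ih =>
    constructor
    · rintro ⟨A, N, x, y, hA, hN, h⟩ i hi Y hY
      exact h.hOrth_third ((hM.mem_iff_hOrth_right N).1 hN i (by omega) Y hY)
        ((ih (by omega) A).1 hA (i + 1) (by omega) Y hY)
    · intro hX
      obtain ⟨K, N, x, p, hN, h, hp⟩ := hM.exists_deflation X
      refine ⟨K, N, x, p, (ih (by omega) K).2 fun i hi Y hY => ?_, hN, h⟩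
      exact hM.hOrth_of_approximation hn hN h hp (m := n - k - 2) (by omega)
        (fun i hi => hX i (by omega)) i (by omega) hY

lemma coneIter_mono (hn : 2 ≤ n) {k l : ℕ} (h : k ≤ l) (hl : l < n) {X : B}
    (hX : S.coneIter M k X) : S.coneIter M l X :=
  (hM.coneIter_iff hn l hl X).2 fun i hi =>
    (hM.coneIter_iff hn k (by omega) X).1 hX i (by omega)

lemma coneIter_of_mem (hn : 2 ≤ n) {k : ℕ} (hk : k < n) {X : B} (hX : M X) : S.coneIter M k X :=
  hM.coneIter_mono hn (Nat.zero_le k) hk hX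

lemma coneIter_biprod (hn : 2 ≤ n) {k : ℕ} (hk : k < n) {X Y : B} (hX : S.coneIter M k X)
    (hY : S.coneIter M k Y) : S.coneIter M k (X ⊞ Y) :=
  (hM.coneIter_iff hn k hk _).2 fun i hi Z hZ =>
    ((hM.coneIter_iff hn k hk X).1 hX i hi Z hZ).biprod_right
      ((hM.coneIter_iff hn k hk Y).1 hY i hi Z hZ)

lemma coneIter_of_retract (hn : 2 ≤ n) {k : ℕ} (hk : k < n) {X Y : B} (hY : S.coneIter M k Y)
    (j : X ⟶ Y) (r : Y ⟶ X) (hr : j ≫ r = 𝟙 X) : S.coneIter M k X :=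
  (hM.coneIter_iff hn k hk _).2 fun i hi Z hZ =>
    ((hM.coneIter_iff hn k hk Y).1 hY i hi Z hZ).of_retract_right j r hr

omit hM in
-- Each cone step costs one degree: for `A ⟶ N ⟶ Z` the group `E^(i+1)(Z, X)` lies between `E^i(A,
-- X)` and `E^(i+1)(N, X)`.
lemma hOrth_coneIter_left {m : ℕ} {X : B} (hX : ∀ Y, M Y → ∀ i, i < m → S.HOrth i Y X) (k : ℕ)
    {Z : B} (hZ : S.coneIter M k Z) (i : ℕ) (hk : k ≤ i) (hi : i < m) : S.HOrth i Z X := by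
  induction k generalizing Z i with
  | zero => exact hX Z hZ i hi
  | succ k ih =>
    obtain ⟨A, N, x, y, hA, hN, h⟩ := hZ
    obtain ⟨i, rfl⟩ : ∃ i', i = i' + 1 := ⟨i - 1, by omega⟩
    exact h.hOrth_third_left (ih hA i (by omega) (by omega)) (hX N hN _ hi)

/-- Given `Z ⟶ N ⟶ X` and, by induction, `V ⟶ U ⟶ Z`, the syzygy-like term `V` is shifted to `ΣV` at
the price of enlarging `U` to a cone of `U ⟶ I ⊞ N`. -/
lemma cone_of_coneIter (j k : ℕ) {X : B} (hX : S.coneIter M (j + k + 1) X) :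
    S.Cone (S.cosyzygy (S.coneIter M k) j) (S.coneIter M j) X := by
  induction j generalizing X with
  | zero => simpa [coneIter, cosyzygy] using hX
  | succ j ih =>
    rw [show j + 1 + k + 1 = (j + k + 1) + 1 by omega] at hX
    obtain ⟨Z, N, x, y, hZ, hN, h⟩ := hX
    obtain ⟨V, U, v, u, hV, hU, h'⟩ := ih hZ
    obtain ⟨I, a, b, hI, h''⟩ := S.sigma_spec V
    obtain ⟨δ', h'⟩ := h'
    obtain ⟨δ'', h''⟩ := h''
    -- The pushout `Q` of `I` and `U` under `V` splits as `I ⊞ Z` because `I` is injective; the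
    -- other conflation reads `U ⟶ I ⊞ Z ⟶ ΣV`.
    obtain ⟨Q, i₁, p₁, i₂, p₂, hQ, hQ'⟩ := h''.exists_pushout h'
    obtain ⟨e, he, -⟩ := IsConflation.exists_iso_biprod ⟨_, hQ⟩ (hI Z)
    have h₁ := hQ'.of_iso e
    have h₂ : S.IsConflation (biprod.map (𝟙 I) x) (biprod.map (0 : I ⟶ 0) y) :=
      IsConflation.biprod_map ⟨_, realizes_id_zero S I⟩ h
    -- Composition with `I ⊞ Z ⟶ I ⊞ N` gives `U ⟶ I ⊞ N ⟶ C` and `ΣV ⟶ C ⟶ X`, so `C` lies one step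
    -- higher in the tower.
    obtain ⟨C, z, c, d, h₃, h₄⟩ := h₁.comp_inflation h₂
    let φ : (0 : B) ⊞ X ≅ X := ⟨biprod.snd, biprod.inr, by ext; simp, by simp⟩
    obtain ⟨δ, h₄⟩ := h₄
    exact ⟨_, _, c, d ≫ φ.hom, ⟨V, I, a, b, hV, hI, _, h''⟩,
      ⟨U, _, _, z, hU, hM.mem_biprod (hM.mem_of_inj hI) hN, h₃⟩, _, h₄.of_iso_right φ⟩

/-! ### The pairs `(M_(j+1), Σ^j M_(k+1))` with `j + k + 2 = n`, that is, `ℓ = j + 1` and `n - ℓ = k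
+ 1`. -/

variable {j k : ℕ}

lemma orth_coneIter_cosyzygy (hn : j + k + 2 = n) {U X : B} (hU : S.coneIter M j U)
    (hX : S.cosyzygy (S.coneIter M k) j X) : S.Orth U X := by
  refine hOrth_of_cosyzygy (S := S) 0 j (fun Z hZ => ?_) hX
  rw [zero_add]
  exact hOrth_coneIter_left (m := j + 1) (fun Y hY i hi =>
    (hM.coneIter_iff (by omega) k (by omega) Z).1 hZ i (by omega) Y hY) j hU j le_rfl (by omega)

lemma cone_cosyzygy (hn : j + k + 2 = n) (X : B) :
    S.Cone (S.cosyzygy (S.coneIter M k) j) (S.coneIter M j) X :=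
  hM.cone_of_coneIter j k
    ((hM.coneIter_iff (by omega) _ (by omega) X).2 fun i hi => by omega)

/-- Salce's trick: pull `V ⟶ U ⟶ ΣX` back along `I ⟶ ΣX`. Injectives lie in `M`, so `E(I, V) = 0`
and the pullback is `V ⊞ I`, which is again in the right-hand class. -/
lemma cocone_cosyzygy (hn : j + k + 2 = n) (X : B) :
    S.CoCone (S.cosyzygy (S.coneIter M k) j) (S.coneIter M j) X := by
  obtain ⟨I, a, b, hI, δ, h⟩ := S.sigma_spec X
  obtain ⟨V, U, v, u, hV, hU, δ', h'⟩ := hM.cone_cosyzygy hn (S.sigma X)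
  obtain ⟨Q, i₁, p₁, i₂, p₂, h₁, h₂⟩ := h.exists_pullback h'
  obtain ⟨e, -, -⟩ := IsConflation.exists_iso_biprod ⟨_, h₂⟩
    (hM.orth_coneIter_cosyzygy hn (hM.coneIter_of_mem (by omega) (by omega) (hM.mem_of_inj hI)) hV)
  exact ⟨_, U, _, _, cosyzygy_biprod (fun X Y => hM.coneIter_biprod (by omega) (by omega)) j hV
    (cosyzygy_of_inj (fun I hI => hM.coneIter_of_mem (by omega) (by omega) (hM.mem_of_inj hI)) j hI),
    hU, h₁.of_iso e⟩

/-- The slack `t` makes the induction on `j` possible: passing from `X` to a first syzygy `Z'`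
lowers `j` by one and gains one degree of vanishing, with `k` fixed. -/
lemma cosyzygy_of_hOrth (t : ℕ) (hn : j + k + 2 + t = n) {X : B}
    (hX : ∀ Z, S.coneIter M j Z → ∀ i, i ≤ t → S.HOrth i Z X) :
    S.cosyzygy (S.coneIter M k) j X := by
  induction j generalizing X t with
  | zero =>
    exact (hM.coneIter_iff (by omega) k (by omega) X).2 fun i hi Y hY => hX Y hY i (by omega)
  | succ j ih =>
    have hn' : j + 1 + (k + t) + 2 = n := by omega
    obtain ⟨V, U, v, u, hV, hU, h⟩ := hM.cocone_cosyzygy hn' X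
    have hUX : S.Orth U X := hX U hU 0 (Nat.zero_le t)
    -- Now `V ≅ X ⊞ U`. Composing `I ⟶ V` with the projection to `X` gives `Z' ⟶ I ⟶ X`, and `Z'` is
    -- an extension of `U` by `Z`. The latter controls `E(-, Z')`, the former the higher degrees.
    obtain ⟨e, -, -⟩ := h.exists_iso_biprod hUX
    have hV' := fun {Y} (hY : S.coneIter M (j + 1) Y) => hM.orth_coneIter_cosyzygy hn' hY hV
    obtain ⟨Z, I, z, p, hZ, hI, h'⟩ := hV
    have h₁ : S.IsConflation (biprod.inr ≫ e.inv : U ⟶ V) (e.hom ≫ biprod.fst : V ⟶ X) :=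
      ⟨0, realizes_split _ _ (e.hom ≫ biprod.snd) (biprod.inl ≫ e.inv) (by simp) (by simp)
        (by simp) (by simp) (by
          have := congrArg (e.hom ≫ · ≫ e.inv) (biprod.total (X := X) (Y := U))
          simp only [Preadditive.comp_add, Preadditive.add_comp, Category.assoc, Category.id_comp,
            e.hom_inv_id] at this
          rw [← this, add_comm]
          simp only [Category.assoc])⟩
    obtain ⟨Z', z', a, b, h₂, h₃⟩ := h₁.comp_deflation h'
    refine ⟨Z', I, _, _, ih (t + 1) (by omega) fun Y hY i hi => ?_, hI, h₂⟩
    have hY' := hM.coneIter_mono (by omega) (Nat.le_succ j) (by omega) hY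
    cases i with
    | zero =>
      have hYU : S.Orth Y U :=
        (hV' hY').of_retract_right (biprod.inr ≫ e.inv) (e.hom ≫ biprod.snd) (by simp)
      refine h₃.hOrth_mid (hOrth_of_cosyzygy 0 j (fun Z₀ hZ₀ => ?_) hZ) hYU
      rw [zero_add]
      exact hOrth_coneIter_left (m := j + 2) (fun Y hY i hi =>
        (hM.coneIter_iff (by omega) _ (by omega) Z₀).1 hZ₀ i (by omega) Y hY) j hY j le_rfl
        (by omega)
    | succ i => exact h₂.hOrth_first (hX Y hY' i (by omega)) (.of_inj hI)

lemma cosyzygy_iff_orth (hn : j + k + 2 = n) (X : B) :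
    S.cosyzygy (S.coneIter M k) j X ↔ ∀ U, S.coneIter M j U → S.Orth U X :=
  ⟨fun hX _ hU => hM.orth_coneIter_cosyzygy hn hU hX, fun hX =>
    hM.cosyzygy_of_hOrth 0 hn fun Z hZ i hi => by
      obtain rfl : i = 0 := by omega
      exact hX Z hZ⟩

theorem isCotorsionPair (hn : j + k + 2 = n) :
    S.IsCotorsionPair (S.coneIter M j) (S.cosyzygy (S.coneIter M k) j) where
  additive_left :=
    { zero := fun X hX => (hM.coneIter_iff (by omega) j (by omega) X).2 fun i _ Y _ =>
        hOrth_iff_omega.2 (Orth.zero_right hX)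
      biprod := fun X Y => hM.coneIter_biprod (by omega) (by omega)
      iso := fun X Y e hX => hM.coneIter_of_retract (by omega) (by omega) hX e.inv e.hom (by simp) }
  additive_right :=
    { zero := fun X hX => (hM.cosyzygy_iff_orth hn X).2 fun U _ => Orth.zero_right hX
      biprod := fun X Y hX hY => (hM.cosyzygy_iff_orth hn _).2 fun U hU =>
        ((hM.cosyzygy_iff_orth hn X).1 hX U hU).biprod_right
          ((hM.cosyzygy_iff_orth hn Y).1 hY U hU)
      iso := fun X Y e hX => (hM.cosyzygy_iff_orth hn Y).2 fun U hU =>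
        ((hM.cosyzygy_iff_orth hn X).1 hX U hU).of_retract_right e.inv e.hom (by simp) }
  summands_left X Y h :=
    hM.coneIter_of_retract (by omega) (by omega) h biprod.inl biprod.fst (by simp)
  summands_right X Y h := (hM.cosyzygy_iff_orth hn X).2 fun U hU =>
    ((hM.cosyzygy_iff_orth hn _).1 h U hU).of_retract_right biprod.inl biprod.fst (by simp)
  ext_eq_zero X Y hX hY := hM.orth_coneIter_cosyzygy hn hX hY
  cone := hM.cone_cosyzygy hn
  cocone := hM.cocone_cosyzygy hn

end IsClusterTilting

end ClusterTilting

end ExtStructure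

/-! ### Reflections and coreflections onto full subcategories -/

section Reflection

variable {C : Type u} [Category.{v} C]

/-- Pointwise reflections assemble into an adjoint whose unit consists of the chosen arrows; the
predicate `R` carries their extra properties over to that unit. -/
lemma ObjectProperty.exists_leftAdjoint_ι (P : ObjectProperty C)
    (R : ∀ ⦃X Y : C⦄, (X ⟶ Y) → Prop)
    (h : ∀ X, ∃ (Y : C) (η : X ⟶ Y), P Y ∧ R η ∧
      ∀ Z, P Z → Function.Bijective (fun f : Y ⟶ Z => η ≫ f)) :
    ∃ (F : C ⥤ P.FullSubcategory) (adj : F ⊣ P.ι), ∀ X, R (adj.unit.app X) := by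
  choose r η hr hR hη using h
  let e : ∀ (X : C) (Z : P.FullSubcategory),
      ((⟨r X, hr X⟩ : P.FullSubcategory) ⟶ Z) ≃ (X ⟶ P.ι.obj Z) := fun X Z =>
    P.fullyFaithfulι.homEquiv.trans (Equiv.ofBijective _ (hη X Z.obj Z.property))
  refine ⟨_, Adjunction.adjunctionOfEquivLeft e (fun X Z Z' g f => ?_), fun X => ?_⟩
  · exact (Category.assoc (η X) f.hom g.hom).symm
  · have : ((Adjunction.adjunctionOfEquivLeft e fun X Z Z' g f =>
        (Category.assoc (η X) f.hom g.hom).symm).unit.app X) = η X := by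
      simp only [Adjunction.adjunctionOfEquivLeft, Adjunction.mkOfHomEquiv_unit_app]
      exact Category.comp_id (η X)
    rw [this]
    exact hR X

lemma ObjectProperty.exists_rightAdjoint_ι (P : ObjectProperty C)
    (R : ∀ ⦃X Y : C⦄, (X ⟶ Y) → Prop)
    (h : ∀ X, ∃ (Y : C) (ε : Y ⟶ X), P Y ∧ R ε ∧
      ∀ Z, P Z → Function.Bijective (fun f : Z ⟶ Y => f ≫ ε)) :
    ∃ (G : C ⥤ P.FullSubcategory) (adj : P.ι ⊣ G), ∀ X, R (adj.counit.app X) := by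
  choose r ε hr hR hε using h
  let e : ∀ (Z : P.FullSubcategory) (X : C),
      (P.ι.obj Z ⟶ X) ≃ (Z ⟶ (⟨r X, hr X⟩ : P.FullSubcategory)) := fun Z X =>
    (P.fullyFaithfulι.homEquiv.trans (Equiv.ofBijective _ (hε X Z.obj Z.property))).symm
  have he : ∀ (Z' Z : P.FullSubcategory) (X : C) (f : Z' ⟶ Z) (g : P.ι.obj Z ⟶ X),
      e Z' X (P.ι.map f ≫ g) = f ≫ e Z X g := fun Z' Z X f g => by
    rw [Equiv.symm_apply_eq]
    obtain ⟨g, rfl⟩ := (e Z X).symm.surjective g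
    rw [Equiv.apply_symm_apply]
    exact (Category.assoc f.hom g.hom (ε X)).symm
  refine ⟨_, Adjunction.adjunctionOfEquivRight e he, fun X => ?_⟩
  have : (Adjunction.adjunctionOfEquivRight e he).counit.app X = ε X := by
    simp only [Adjunction.adjunctionOfEquivRight, Adjunction.mkOfHomEquiv_counit_app]
    exact Category.id_comp (ε X)
  rw [this]
  exact hR X

end Reflection

namespace ExtStructure

open ZeroObject

set_option linter.unusedSectionVars false

/-! ### Hearts of cotorsion pairs -/

section CotorsionPair

variable {B : Type u} [Category.{v} B] [Preadditive B] [HasZeroObject B] [HasBinaryBiproducts B]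
  {S : ExtStructure.{w} B} [S.IsExtriangulated] {U V : ObjectProperty B}

namespace IsCotorsionPair

variable (h : S.IsCotorsionPair U V)
include h

/-- If `X` is orthogonal to `V`, its approximation sequence splits and `X` is a summand of an object
of `U`. -/
lemma left_iff (X : B) : U X ↔ ∀ Y, V Y → S.Orth X Y := by
  refine ⟨fun hX Y hY => h.ext_eq_zero X Y hX hY, fun hX => ?_⟩
  obtain ⟨A, Z, x, y, hA, hZ, hc⟩ := h.cone X
  obtain ⟨e, -, -⟩ := hc.exists_iso_biprod (hX A hA)
  exact h.summands_left X A (h.additive_left.iso Z _ (e ≪≫ biprod.braiding A X) hZ)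

lemma right_iff (Y : B) : V Y ↔ ∀ X, U X → S.Orth X Y := by
  refine ⟨fun hY X hX => h.ext_eq_zero X Y hX hY, fun hY => ?_⟩
  obtain ⟨Z, C, x, y, hZ, hC, hc⟩ := h.cocone Y
  obtain ⟨e, -, -⟩ := hc.exists_iso_biprod (hY C hC)
  exact h.summands_right Y C (h.additive_right.iso Z _ e hZ)

lemma left_of_conflation {A X C : B} {x : A ⟶ X} {y : X ⟶ C} (hc : S.IsConflation x y)
    (hA : U A) (hC : U C) : U X :=
  (h.left_iff X).2 fun Y hY => hc.orth_mid_left ((h.left_iff A).1 hA Y hY)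
    ((h.left_iff C).1 hC Y hY)

lemma right_of_conflation {A X C : B} {x : A ⟶ X} {y : X ⟶ C} (hc : S.IsConflation x y)
    (hA : V A) (hC : V C) : V X :=
  (h.right_iff X).2 fun Y hY => hc.orth_mid ((h.right_iff A).1 hA Y hY)
    ((h.right_iff C).1 hC Y hY)

lemma core_isAdditiveSubcategory : IsAdditiveSubcategory (U ⊓ V) where
  zero X hX := ⟨h.additive_left.zero X hX, h.additive_right.zero X hX⟩
  biprod X Y hX hY := ⟨h.additive_left.biprod X Y hX.1 hY.1, h.additive_right.biprod X Y hX.2 hY.2⟩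
  iso X Y e hX := ⟨h.additive_left.iso X Y e hX.1, h.additive_right.iso X Y e hX.2⟩

/-- A morphism from an object of `U` to an object of `B⁺` factors through the core. -/
lemma exists_factor_plus {X Y : B} (hX : U X) (hY : S.plus U V Y) (f : X ⟶ Y) :
    ∃ (Z : B) (a : X ⟶ Z) (b : Z ⟶ Y), (U ⊓ V) Z ∧ a ≫ b = f := by
  obtain ⟨A, Z, x, y, hA, hZ, δ, hc⟩ := hY
  obtain ⟨g, hg⟩ := hc.exists_lift f (h.ext_eq_zero X A hX hA _)
  exact ⟨Z, g, y, hZ, hg⟩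

/-- A morphism from an object of `B⁻` to an object of `V` factors through the core. -/
lemma exists_factor_minus {X Y : B} (hX : S.minus U V X) (hY : V Y) (f : X ⟶ Y) :
    ∃ (Z : B) (a : X ⟶ Z) (b : Z ⟶ Y), (U ⊓ V) Z ∧ a ≫ b = f := by
  obtain ⟨Z, C, x, y, hZ, hC, δ, hc⟩ := hX
  obtain ⟨g, hg⟩ := hc.exists_extension f (h.ext_eq_zero C Y hC hY _)
  exact ⟨Z, x, g, hZ, hg⟩

/-- Embed the middle term `Y ∈ U` into `V` with cokernel in `U`; the new middle term is in the core,
and the new cokernel is an extension of objects of `U`. -/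
lemma minus_of_cocone {X : B} (hX : S.CoCone U U X) : S.minus U V X := by
  obtain ⟨Y, C, x, y, hY, hC, hc⟩ := hX
  obtain ⟨Z, C', a, b, hZ, hC', hc'⟩ := h.cocone Y
  obtain ⟨Q, q, d, e, h₁, h₂⟩ := hc.comp_inflation hc'
  exact ⟨Z, Q, _, q, ⟨h.left_of_conflation hc' hY hC', hZ⟩, h.left_of_conflation h₂ hC hC', h₁⟩

lemma plus_of_cone {X : B} (hX : S.Cone V V X) : S.plus U V X := by
  obtain ⟨A, Y, x, y, hA, hY, hc⟩ := hX
  obtain ⟨A', Z, a, b, hA', hZ, hc'⟩ := h.cone Y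
  obtain ⟨Q, q, d, e, h₁, h₂⟩ := hc.comp_deflation hc'
  exact ⟨Q, Z, q, _, h.right_of_conflation h₂ hA' hA, ⟨hZ, h.right_of_conflation hc' hA' hY⟩, h₁⟩

/-- The conflation `X ⟶ X⁺ ⟶ C` that underlies the reflection of `X` onto `B⁺`. -/
lemma exists_plus (X : B) : ∃ (Y C D : B) (x : X ⟶ Y) (y : Y ⟶ C) (u : D ⟶ X) (θ : S.Ext C D),
    S.plus U V Y ∧ U C ∧ U D ∧ Realizes x y (push u θ) := by
  obtain ⟨A, D, a, u, hA, hD, δ, h₁⟩ := h.cone X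
  obtain ⟨Z, C, b, c, hZ, hC, δ', h₂⟩ := h.cocone D
  obtain ⟨Y, y, d, e, δ'', h₃, -, -, h₄, -⟩ := IsExtriangulated.et4 h₁ h₂
  exact ⟨Y, C, D, d, e, u, δ', ⟨A, Z, _, y, hA, ⟨h.left_of_conflation ⟨_, h₂⟩ hD hC, hZ⟩, _, h₃⟩,
    hC, hD, h₄⟩

/-- The conflation `A ⟶ X⁻ ⟶ X` that underlies the coreflection of `X` onto `B⁻`. -/
lemma exists_minus (X : B) : ∃ (Y A D C : B) (x : A ⟶ Y) (y : Y ⟶ X) (v : X ⟶ D) (θ : S.Ext D A)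
    (z : D ⟶ C) (ζ : S.Ext C Y),
    S.minus U V Y ∧ V A ∧ V D ∧ Realizes x y (pull v θ) ∧ Realizes v z (push y ζ) := by
  obtain ⟨D, C, v, c, hD, hC, δ, h₁⟩ := h.cocone X
  obtain ⟨A, Z, a, b, hA, hZ, δ', h₂⟩ := h.cone D
  obtain ⟨Y, y, d, e, δ'', h₃, -, -, h₄, h₅, -⟩ := IsExtriangulated.et4_op h₁ h₂
  refine ⟨Y, A, D, C, e, d, v, δ', c, δ'',
    ⟨Z, C, y, _, ⟨hZ, h.right_of_conflation ⟨_, h₂⟩ hA hD⟩, hC, _, h₃⟩, hA, hD, h₄, ?_⟩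
  rw [h₅]
  exact h₁

section

variable {X Y C D : B} {x : X ⟶ Y} {y : Y ⟶ C} {u : D ⟶ X} {θ : S.Ext C D}

/-- The class of `X ⟶ Y ⟶ C` is pushed forward from `D ∈ U`. The composite `D ⟶ X ⟶ Z` factors
through the core, and `E(C, W) = 0`, so the obstruction to extending `g` vanishes. -/
lemma exists_extension_plus (hC : U C) (hD : U D) (hr : Realizes x y (push u θ)) {Z : B}
    (hZ : S.plus U V Z) (g : X ⟶ Z) : ∃ g' : Y ⟶ Z, x ≫ g' = g := by
  obtain ⟨T, a, b, hT, hab⟩ := h.exists_factor_plus hD hZ (u ≫ g)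
  refine hr.exists_extension g ?_
  rw [← push_comp, ← hab, push_comp, h.ext_eq_zero C T hC hT.2 (push a θ), push_zero]

/-- After the factorization of `x ≫ (f - g)` is extended to `Y`, the remaining difference factors
through `C ∈ U`, hence through the core because `Z ∈ B⁺`. -/
lemma idealRel_of_precomp (hC : U C) (hr : Realizes x y (push u θ)) {Z : B}
    (hZ : S.plus U V Z) (f g : Y ⟶ Z) (hfg : idealRel (U ⊓ V) (x ≫ f) (x ≫ g)) :
    idealRel (U ⊓ V) f g := by
  have := h.core_isAdditiveSubcategory
  obtain ⟨T, a, b, hT, hab⟩ := hfg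
  obtain ⟨a', rfl⟩ := hr.exists_extension a (h.ext_eq_zero C T hC hT.2 _)
  obtain ⟨k, hk⟩ := hr.exists_desc (f - g - a' ≫ b) (by simp at hab ⊢; rw [hab]; abel)
  obtain ⟨T', c, d, hT', rfl⟩ := h.exists_factor_plus hC hZ k
  refine ⟨_, biprod.lift a' (y ≫ c), biprod.desc b d, this.biprod _ _ hT hT', ?_⟩
  rw [biprod.lift_desc, Category.assoc, hk]
  abel

/-- Reflecting onto `B⁺` preserves `B⁻`: the pushout of `Z ∈ W` and `Y` under `X` is an extension of
`C` by `Z`, so `Y` lies in `CoCone(U, U)`. -/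
lemma minus_plus (hC : U C) (hr : S.IsConflation x y) (hX : S.minus U V X) : S.minus U V Y := by
  obtain ⟨Z, C', a, b, hZ, hC', δ, h₁⟩ := hX
  obtain ⟨θ, hr⟩ := hr
  obtain ⟨Q, i₁, p₁, i₂, p₂, h₂, h₃⟩ := h₁.exists_pushout hr
  exact h.minus_of_cocone ⟨Q, C', _, _, h.left_of_conflation ⟨_, h₂⟩ hZ.1 hC, hC', h₃⟩

end

section

variable {X Y A D : B} {x : A ⟶ Y} {y : Y ⟶ X} {v : X ⟶ D} {θ : S.Ext D A}

lemma exists_lift_minus (hA : V A) (hD : V D) (hr : Realizes x y (pull v θ)) {Z : B}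
    (hZ : S.minus U V Z) (g : Z ⟶ X) : ∃ g' : Z ⟶ Y, g' ≫ y = g := by
  obtain ⟨T, a, b, hT, hab⟩ := h.exists_factor_minus hZ hD (g ≫ v)
  refine hr.exists_lift g ?_
  rw [← pull_comp, ← hab, pull_comp, h.ext_eq_zero T A hT.1 hA (pull b θ), pull_zero]

lemma idealRel_of_postcomp (hA : V A) (hr : Realizes x y (pull v θ)) {Z : B}
    (hZ : S.minus U V Z) (f g : Z ⟶ Y) (hfg : idealRel (U ⊓ V) (f ≫ y) (g ≫ y)) :
    idealRel (U ⊓ V) f g := by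
  have := h.core_isAdditiveSubcategory
  obtain ⟨T, a, b, hT, hab⟩ := hfg
  obtain ⟨b', rfl⟩ := hr.exists_lift b (h.ext_eq_zero T A hT.1 hA _)
  obtain ⟨k, hk⟩ := hr.exists_lift_kernel (f - g - a ≫ b') (by simp at hab ⊢; rw [hab]; abel)
  obtain ⟨T', c, d, hT', rfl⟩ := h.exists_factor_minus hZ hA k
  refine ⟨_, biprod.lift a c, biprod.desc b' (d ≫ x), this.biprod _ _ hT hT', ?_⟩
  rw [biprod.lift_desc, ← Category.assoc, hk]
  abel

lemma plus_minus (hA : V A) (hr : S.IsConflation x y) (hX : S.plus U V X) : S.plus U V Y := by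
  obtain ⟨A', Z, a, b, hA', hZ, δ, h₁⟩ := hX
  obtain ⟨θ, hr⟩ := hr
  obtain ⟨Q, i₁, p₁, i₂, p₂, h₂, h₃⟩ := h₁.exists_pullback hr
  exact h.plus_of_cone ⟨A', Q, _, _, hA', h.right_of_conflation ⟨_, h₃⟩ hA hZ.2, h₂⟩

end

end IsCotorsionPair

variable (S) in
/-- The morphism `f` induces isomorphisms `E(N, X) ≅ E(N, Y)` for `N ∈ M`. -/
def ExtIso (M : ObjectProperty B) {X Y : B} (f : X ⟶ Y) : Prop :=
  ∀ N, M N → Function.Bijective (fun δ : S.Ext N X => push f δ)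

namespace IsCotorsionPair

variable (h : S.IsCotorsionPair U V) {M : ObjectProperty B}
include h

/-- Surjectivity is `E(N, C) = 0`. The kernel consists of pullbacks of `u_* θ`, which come from
`E(N, D) = 0`. -/
lemma extIso_plus (hM : ∀ X Y, M X → U Y → S.Orth X Y) {X Y C D : B} {x : X ⟶ Y} {y : Y ⟶ C}
    {u : D ⟶ X} {θ : S.Ext C D} (hC : U C) (hD : U D) (hr : Realizes x y (push u θ)) :
    S.ExtIso M x := fun N hN => by
  constructor
  · intro ε ε' hε
    have h₀ : push x (ε - ε') = 0 := by rw [push_map_sub]; exact sub_eq_zero.2 hε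
    obtain ⟨c, hc⟩ := hr.exists_pull_eq _ h₀
    rw [pull_push, hM N D hN hD (pull c θ), push_zero] at hc
    exact sub_eq_zero.1 hc.symm
  · intro ε
    exact hr.exists_push_left ε (hM N C hN hC _)

/-- Injectivity is `E(N, A) = 0`. For surjectivity, `E(N, D) = 0` makes every extension a pullback
of `y_* ζ`, visibly in the image of `y_*`. -/
lemma extIso_minus (hM : ∀ X, M X → U X) {X Y A D C : B} {x : A ⟶ Y} {y : Y ⟶ X} {v : X ⟶ D}
    {θ : S.Ext D A} {z : D ⟶ C} {ζ : S.Ext C Y} (hA : V A) (hD : V D)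
    (hr : Realizes x y (pull v θ)) (hr' : Realizes v z (push y ζ)) :
    S.ExtIso M y := fun N hN => by
  constructor
  · intro ε ε' hε
    have h₀ : push y (ε - ε') = 0 := by rw [push_map_sub]; exact sub_eq_zero.2 hε
    obtain ⟨ε₀, hε₀⟩ := hr.exists_push_left _ h₀
    rw [h.ext_eq_zero N A (hM N hN) hA ε₀, push_zero] at hε₀
    exact sub_eq_zero.1 hε₀.symm
  · intro ε
    obtain ⟨c, hc⟩ := hr'.exists_pull_eq ε (h.ext_eq_zero N D (hM N hN) hD _)
    exact ⟨pull c ζ, by rw [← hc, pull_push]⟩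

lemma toAddQuotient_map_eq_iff {X Y : B} (f g : X ⟶ Y) :
    (toAddQuotient (U ⊓ V)).map f = (toAddQuotient (U ⊓ V)).map g ↔ idealRel (U ⊓ V) f g := by
  have := h.core_isAdditiveSubcategory
  exact Quotient.functor_map_eq_iff _ _ _

lemma exists_reflection (hM : ∀ X Y, M X → U Y → S.Orth X Y) :
    ∃ (σp : AddQuotient (U ⊓ V) ⥤ SubQuotient (S.plus U V) (U ⊓ V))
      (adj : σp ⊣ subQuotientIncl (S.plus U V) (U ⊓ V)), ∀ X,
      (S.minus U V X.as → S.minus U V (σp.obj X).obj.as) ∧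
      ∃ f : X.as ⟶ (σp.obj X).obj.as, adj.unit.app X = (toAddQuotient (U ⊓ V)).map f ∧
        S.ExtIso M f := by
  refine ObjectProperty.exists_leftAdjoint_ι (inAddQuotient (S.plus U V) (U ⊓ V))
    (fun X Y η => (S.minus U V X.as → S.minus U V Y.as) ∧
      ∃ f : X.as ⟶ Y.as, η = (toAddQuotient (U ⊓ V)).map f ∧ S.ExtIso M f) fun X => ?_
  obtain ⟨Y, C, D, x, y, u, θ, hY, hC, hD, hr⟩ := h.exists_plus X.as
  refine ⟨⟨Y⟩, (toAddQuotient (U ⊓ V)).map x, hY, ⟨h.minus_plus hC ⟨_, hr⟩, x, rfl,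
    h.extIso_plus hM hC hD hr⟩, fun Z hZ => ⟨fun f g hfg => ?_, fun g => ?_⟩⟩
  · obtain ⟨f, rfl⟩ := (toAddQuotient (U ⊓ V)).map_surjective (X := Y) (Y := Z.as) f
    obtain ⟨g, rfl⟩ := (toAddQuotient (U ⊓ V)).map_surjective (X := Y) (Y := Z.as) g
    refine (h.toAddQuotient_map_eq_iff f g).2 (h.idealRel_of_precomp hC hr hZ f g ?_)
    exact (h.toAddQuotient_map_eq_iff _ _).1 (by simpa only [Functor.map_comp] using hfg)
  · obtain ⟨g, rfl⟩ := (toAddQuotient (U ⊓ V)).map_surjective (X := X.as) (Y := Z.as) g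
    obtain ⟨g', rfl⟩ := h.exists_extension_plus hC hD hr hZ g
    exact ⟨(toAddQuotient (U ⊓ V)).map g', ((toAddQuotient (U ⊓ V)).map_comp _ _).symm⟩

lemma exists_coreflection (hM : ∀ X, M X → U X) :
    ∃ (σm : AddQuotient (U ⊓ V) ⥤ SubQuotient (S.minus U V) (U ⊓ V))
      (adj : subQuotientIncl (S.minus U V) (U ⊓ V) ⊣ σm), ∀ X,
      (S.plus U V X.as → S.plus U V (σm.obj X).obj.as) ∧
      ∃ f : (σm.obj X).obj.as ⟶ X.as, adj.counit.app X = (toAddQuotient (U ⊓ V)).map f ∧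
        S.ExtIso M f := by
  refine ObjectProperty.exists_rightAdjoint_ι (inAddQuotient (S.minus U V) (U ⊓ V))
    (fun Y X ε => (S.plus U V X.as → S.plus U V Y.as) ∧
      ∃ f : Y.as ⟶ X.as, ε = (toAddQuotient (U ⊓ V)).map f ∧ S.ExtIso M f) fun X => ?_
  obtain ⟨Y, A, D, C, x, y, v, θ, z, ζ, hY, hA, hD, hr, hr'⟩ := h.exists_minus X.as
  refine ⟨⟨Y⟩, (toAddQuotient (U ⊓ V)).map y, hY, ⟨h.plus_minus hA ⟨_, hr⟩, y, rfl,
    h.extIso_minus hM hA hD hr hr'⟩, fun Z hZ => ⟨fun f g hfg => ?_, fun g => ?_⟩⟩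
  · obtain ⟨f, rfl⟩ := (toAddQuotient (U ⊓ V)).map_surjective (X := Z.as) (Y := Y) f
    obtain ⟨g, rfl⟩ := (toAddQuotient (U ⊓ V)).map_surjective (X := Z.as) (Y := Y) g
    refine (h.toAddQuotient_map_eq_iff f g).2 (h.idealRel_of_postcomp hA hr hZ f g ?_)
    exact (h.toAddQuotient_map_eq_iff _ _).1 (by simpa only [Functor.map_comp] using hfg)
  · obtain ⟨g, rfl⟩ := (toAddQuotient (U ⊓ V)).map_surjective (X := Z.as) (Y := X.as) g
    obtain ⟨g', rfl⟩ := h.exists_lift_minus hA hD hr hZ g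
    exact ⟨(toAddQuotient (U ⊓ V)).map g', ((toAddQuotient (U ⊓ V)).map_comp _ _).symm⟩

end IsCotorsionPair

end CotorsionPair

end ExtStructure

/-! ### Cokernels of functors to abelian groups -/

section Cokernel

universe u₁ v₁

variable {K : Type u₁} [Category.{v₁} K]

/-- A pointwise right exact sequence of functors to abelian groups is a cokernel sequence. -/
lemma nonempty_isColimit_cokernelCofork {F G H : K ⥤ AddCommGrpCat.{v}} (a : F ⟶ G) (q : G ⟶ H)
    (w : a ≫ q = 0) (hq : ∀ k, Function.Surjective (q.app k))
    (ha : ∀ k (y : G.obj k), q.app k y = 0 → ∃ x, a.app k x = y) :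
    Nonempty (IsColimit (CokernelCofork.ofπ q w)) := by
  have key : ∀ {Z : K ⥤ AddCommGrpCat.{v}} (t : G ⟶ Z), a ≫ t = 0 → ∀ k (y y' : G.obj k),
      q.app k y = q.app k y' → t.app k y = t.app k y' := fun t ht k y y' h => by
    obtain ⟨x, hx⟩ := ha k (y - y') (by rw [map_sub, h, sub_self])
    have : t.app k (a.app k x) = 0 := by
      have := congrArg (fun s => s x) (NatTrans.congr_app ht k)
      simpa using this
    rw [hx, map_sub] at this
    exact sub_eq_zero.1 this
  choose s hs using hq
  let desc : ∀ {Z : K ⥤ AddCommGrpCat.{v}} (t : G ⟶ Z), a ≫ t = 0 → (H ⟶ Z) := fun {Z} t ht =>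
    { app := fun k => AddCommGrpCat.ofHom (AddMonoidHom.mk' (fun x => t.app k (s k x))
        fun x y => by
          rw [← map_add]
          exact key t ht k _ _ (by rw [map_add, hs, hs, hs]))
      naturality := fun k k' f => by
        ext x
        have h₁ := congrArg (fun r => r (s k x)) (t.naturality f)
        have h₂ := congrArg (fun r => r (s k x)) (q.naturality f)
        simp only [AddCommGrpCat.comp_apply] at h₁ h₂
        rw [hs] at h₂
        simp only [AddCommGrpCat.comp_apply]
        refine (key t ht k' _ (G.map f (s k x)) ?_).trans h₁
        rw [hs, h₂] }
  have hdesc : ∀ {Z : K ⥤ AddCommGrpCat.{v}} (t : G ⟶ Z) (ht : a ≫ t = 0), q ≫ desc t ht = t :=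
    fun t ht => by
      ext k y
      exact key t ht k _ _ (hs k _)
  have : Epi q := by
    refine ⟨fun f g hfg => ?_⟩
    ext k x
    have := congrArg (fun r => r (s k x)) (NatTrans.congr_app hfg k)
    simpa [hs] using this
  exact ⟨CokernelCofork.IsColimit.ofπ' q w fun t ht => ⟨desc t ht, hdesc t ht⟩⟩

end Cokernel

namespace ExtStructure

open ZeroObject

set_option linter.unusedSectionVars false

/-! ### The functor of extensions restricted to a subcategory -/

section ExtModule

variable {B : Type u} [Category.{v} B] [Preadditive B] [HasZeroObject B] [HasBinaryBiproducts B]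
  (S : ExtStructure.{w} B)

lemma SubQuotient.exists_hom {C D : ObjectProperty B} {X Y : SubQuotient C D} (f : X ⟶ Y) :
    ∃ f₀ : X.obj.as ⟶ Y.obj.as, f = ObjectProperty.homMk ((toAddQuotient D).map f₀) := by
  obtain ⟨f₀, h⟩ := (toAddQuotient D).map_surjective (X := X.obj.as) (Y := Y.obj.as) f.hom
  exact ⟨f₀, InducedCategory.hom_ext h.symm⟩

variable {S} in
/-- The action of morphisms of `B / P` on extensions. -/
def quotientPull {N N' : AddQuotient S.Proj} (c : N' ⟶ N) {X : B} (δ : S.Ext N.as X) :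
    S.Ext N'.as X :=
  Quot.liftOn c (fun c => pull c δ) (by
    -- Representatives differ by a composite through a projective object, on which every extension
    -- vanishes.
    rintro _ _ ⟨_, _, a, f, g, b, P, k, l, hP, h⟩
    have hδ : pull l (pull b δ) = 0 := hP _ _
    rw [← sub_eq_zero, ← pull_sub, ← Preadditive.comp_sub, ← Preadditive.sub_comp, ← h,
      pull_comp, Category.assoc, pull_comp, pull_comp, hδ, pull_zero, pull_zero])

variable [S.IsExtriangulated] [S.EnoughInj]

/-- An injective copresentation makes `E(X, Y)` a quotient of `B(X, ΣY)`. Hence its values can be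
shrunk to the universe of the morphisms, where representable functors take values. -/
instance small_ext (X Y : B) : Small.{v} (S.Ext X Y) := by
  obtain ⟨I, x, y, hI, δ, h⟩ := S.sigma_spec Y
  exact small_of_surjective (f := fun c : X ⟶ S.sigma Y => pull c δ)
    fun ε => h.exists_pull_eq ε (hI _ _)

variable (M : ObjectProperty B)

lemma quotientPull_add {N N' : SubQuotient M S.Proj} (c : N' ⟶ N) {X : B}
    (δ δ' : S.Ext N.obj.as X) : quotientPull c.hom (δ + δ') =
      quotientPull c.hom δ + quotientPull c.hom δ' := by
  obtain ⟨c, rfl⟩ := SubQuotient.exists_hom c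
  exact pull_map_add c δ δ'

/-- The functor `E(-, X)` on `M / P`. -/
noncomputable def extModule (X : B) : (SubQuotient M S.Proj)ᵒᵖ ⥤ AddCommGrpCat.{v} where
  obj N := AddCommGrpCat.of (Shrink.{v} (S.Ext N.unop.obj.as X))
  map c := AddCommGrpCat.ofHom (AddMonoidHom.mk'
    (fun x => equivShrink _ (quotientPull c.unop.hom ((equivShrink _).symm x)))
    fun x y => by rw [equivShrink_symm_add, quotientPull_add, equivShrink_add])
  map_id N := by
    refine AddCommGrpCat.ext fun x => ?_
    change equivShrink _ (pull (𝟙 _) ((equivShrink _).symm x)) = x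
    rw [pull_id, Equiv.apply_symm_apply]
  map_comp {N N' N''} c c' := by
    refine AddCommGrpCat.ext fun x => ?_
    obtain ⟨c₀, hc⟩ := SubQuotient.exists_hom c.unop
    obtain ⟨c₀', hc'⟩ := SubQuotient.exists_hom c'.unop
    obtain rfl : c = (ObjectProperty.homMk ((toAddQuotient S.Proj).map c₀)).op := by rw [← hc]; rfl
    obtain rfl : c' = (ObjectProperty.homMk ((toAddQuotient S.Proj).map c₀')).op := by
      rw [← hc']; rfl
    change equivShrink _ (pull (c₀' ≫ c₀) ((equivShrink _).symm x)) = equivShrink _ (pull c₀'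
      ((equivShrink _).symm (equivShrink _ (pull c₀ ((equivShrink _).symm x)))))
    rw [Equiv.symm_apply_apply, pull_comp]

variable {M}

/-- An extension of `N` by `X`, as an element of the value of `E(-, X)` at `N`. -/
noncomputable def extElem {N X : B} (hN : M N) (δ : S.Ext N X) :
    (S.extModule M X).obj (op ⟨⟨N⟩, hN⟩) :=
  equivShrink _ δ

variable {S}

lemma extElem_surjective {N X : B} (hN : M N) (x : (S.extModule M X).obj (op ⟨⟨N⟩, hN⟩)) :
    ∃ δ : S.Ext N X, S.extElem hN δ = x :=
  (equivShrink _).surjective x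

lemma extElem_injective {N X : B} (hN : M N) {δ δ' : S.Ext N X}
    (h : S.extElem hN δ = S.extElem hN δ') : δ = δ' :=
  (equivShrink _).injective h

lemma extElem_zero {N X : B} (hN : M N) : S.extElem hN (0 : S.Ext N X) = 0 :=
  (Equiv.eq_symm_apply _).1 equivShrink_symm_zero.symm

lemma extElem_add {N X : B} (hN : M N) (δ δ' : S.Ext N X) :
    S.extElem hN (δ + δ') = S.extElem hN δ + S.extElem hN δ' :=
  equivShrink_add δ δ'

variable (M) in
/-- The morphism of `M / P` given by a morphism between objects of `M`. -/
abbrev quotientHom {N N' : B} (hN : M N) (hN' : M N') (c : N ⟶ N') :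
    (⟨⟨N⟩, hN⟩ : SubQuotient M S.Proj) ⟶ ⟨⟨N'⟩, hN'⟩ :=
  ObjectProperty.homMk ((toAddQuotient S.Proj).map c)

lemma extModule_map {N N' X : B} (hN : M N) (hN' : M N') (c : N' ⟶ N) (δ : S.Ext N X) :
    (S.extModule M X).map (quotientHom M hN' hN c).op (S.extElem hN δ) =
      S.extElem hN' (pull c δ) := by
  change equivShrink _ (pull c ((equivShrink _).symm (equivShrink _ δ))) = _
  rw [Equiv.symm_apply_apply]
  rfl

variable (S M)

/-- The functoriality of `E(-, X)` in `X`. -/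
noncomputable def extFunctor : B ⥤ (SubQuotient M S.Proj)ᵒᵖ ⥤ AddCommGrpCat.{v} where
  obj X := S.extModule M X
  map {X Y} f :=
    { app := fun N => AddCommGrpCat.ofHom (AddMonoidHom.mk'
        (fun x => (equivShrink _ (push f ((equivShrink (S.Ext N.unop.obj.as X)).symm x)) :
          Shrink (S.Ext N.unop.obj.as Y)))
        fun x y => by rw [equivShrink_symm_add, push_map_add, equivShrink_add])
      naturality := fun N N' c => by
        ext x
        obtain ⟨c₀, hc⟩ := SubQuotient.exists_hom c.unop
        obtain rfl : c = (ObjectProperty.homMk ((toAddQuotient S.Proj).map c₀)).op := by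
          rw [← hc]; rfl
        change equivShrink _ (push f ((equivShrink _).symm (equivShrink _ (pull c₀
          ((equivShrink (S.Ext N.unop.obj.as X)).symm x))))) =
            equivShrink _ (pull c₀ ((equivShrink _).symm (equivShrink _ (push f
              ((equivShrink (S.Ext N.unop.obj.as X)).symm x)))))
        rw [Equiv.symm_apply_apply, Equiv.symm_apply_apply, pull_push] }
  map_id X := by
    ext N x
    change equivShrink _ (push (𝟙 _) ((equivShrink (S.Ext N.unop.obj.as X)).symm x)) = x
    rw [push_id]
    exact Equiv.apply_symm_apply _ _
  map_comp {X Y Z} f g := by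
    ext N x
    change equivShrink _ (push (f ≫ g) ((equivShrink (S.Ext N.unop.obj.as X)).symm x)) =
      equivShrink _ (push g ((equivShrink _).symm (equivShrink _ (push f
        ((equivShrink (S.Ext N.unop.obj.as X)).symm x)))))
    rw [Equiv.symm_apply_apply, push_comp]

variable {S M}

lemma extFunctor_map_app {N X Y : B} (hN : M N) (f : X ⟶ Y) (δ : S.Ext N X) :
    ((S.extFunctor M).map f).app (op ⟨⟨N⟩, hN⟩) (S.extElem hN δ) = S.extElem hN (push f δ) := by
  change equivShrink _ (push f ((equivShrink _).symm (equivShrink _ δ))) = _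
  rw [Equiv.symm_apply_apply]
  rfl

lemma extFunctor_map_eq_iff {X Y : B} (f g : X ⟶ Y) :
    (S.extFunctor M).map f = (S.extFunctor M).map g ↔
      ∀ N, M N → ∀ δ : S.Ext N X, push f δ = push g δ := by
  constructor
  · intro h N hN δ
    apply extElem_injective hN
    rw [← extFunctor_map_app, ← extFunctor_map_app, h]
  · intro h
    ext ⟨⟨⟨N⟩, (hN : M N)⟩⟩ x
    obtain ⟨δ, rfl⟩ := extElem_surjective hN x
    exact (extFunctor_map_app hN f δ).trans ((congrArg _ (h N hN δ)).trans
      (extFunctor_map_app hN g δ).symm)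

lemma isIso_extFunctor_map {X Y : B} (f : X ⟶ Y) (hf : S.ExtIso M f) :
    IsIso ((S.extFunctor M).map f) := by
  have : ∀ N, IsIso (((S.extFunctor M).map f).app N) := by
    rintro ⟨⟨⟨N⟩, (hN : M N)⟩⟩
    rw [ConcreteCategory.isIso_iff_bijective]
    constructor
    · intro x y hxy
      obtain ⟨δ, rfl⟩ := extElem_surjective hN x
      obtain ⟨δ', rfl⟩ := extElem_surjective hN y
      rw [extFunctor_map_app, extFunctor_map_app] at hxy
      rw [(hf N hN).1 (extElem_injective hN hxy)]
    · intro y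
      obtain ⟨ε, rfl⟩ := extElem_surjective hN y
      obtain ⟨δ, rfl⟩ := (hf N hN).2 ε
      exact ⟨_, extFunctor_map_app hN f δ⟩
  exact NatIso.isIso_of_isIso_app _

/-- The morphism from a representable functor to `E(-, X)` given by an extension. -/
noncomputable def ofExtension {N X : B} (hN : M N) (δ : S.Ext N X) :
    preadditiveYoneda.obj (⟨⟨N⟩, hN⟩ : SubQuotient M S.Proj) ⟶ S.extModule M X where
  app N' := AddCommGrpCat.ofHom (AddMonoidHom.mk'
    (fun c : N'.unop ⟶ ⟨⟨N⟩, hN⟩ => (S.extModule M X).map c.op (S.extElem hN δ))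
    fun c c' => by
      obtain ⟨c, rfl⟩ := SubQuotient.exists_hom c
      obtain ⟨c', rfl⟩ := SubQuotient.exists_hom c'
      have := extModule_map (S := S) hN N'.unop.property (c + c') δ
      rw [pull_add, extElem_add, ← extModule_map, ← extModule_map] at this
      exact this)
  naturality N' N'' f := by
    ext c
    exact congrArg (fun r => r (S.extElem hN δ)) ((S.extModule M X).map_comp c.op f)

lemma ofExtension_app {N N' X : B} (hN : M N) (hN' : M N') (δ : S.Ext N X) (c : N' ⟶ N) :
    (ofExtension hN δ).app (op ⟨⟨N'⟩, hN'⟩) (quotientHom M hN' hN c) = S.extElem hN' (pull c δ) :=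
  extModule_map hN hN' c δ

/-- If `δ` is a universal extension by `X` and `g` is a weak kernel of `δ`, then
`(M/P)(-, N₁) ⟶ (M/P)(-, N₀) ⟶ E(-, X) ⟶ 0` is exact. -/
lemma isCokernel_ofExtension {N₀ N₁ X : B} (h₀ : M N₀) (h₁ : M N₁) (δ : S.Ext N₀ X)
    (g : N₁ ⟶ N₀) (hg : pull g δ = 0)
    (hδ : ∀ N, M N → ∀ ε : S.Ext N X, ∃ c : N ⟶ N₀, pull c δ = ε)
    (hker : ∀ N, M N → ∀ c : N ⟶ N₀, pull c δ = 0 →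
      ∃ c' : N ⟶ N₁, (toAddQuotient S.Proj).map (c' ≫ g) = (toAddQuotient S.Proj).map c) :
    ∃ w : preadditiveYoneda.map (quotientHom M h₁ h₀ g) ≫ ofExtension h₀ δ = 0,
      Nonempty (IsColimit (CokernelCofork.ofπ (ofExtension h₀ δ) w)) := by
  have w : preadditiveYoneda.map (quotientHom M h₁ h₀ g) ≫ ofExtension h₀ δ = 0 := by
    ext ⟨N⟩ c
    obtain ⟨c, rfl⟩ := SubQuotient.exists_hom c
    have h₂ := ofExtension_app h₀ N.property δ (c ≫ g)
    rw [pull_comp, hg, pull_zero, extElem_zero] at h₂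
    exact h₂
  refine ⟨w, nonempty_isColimit_cokernelCofork _ _ w ?_ ?_⟩
  · rintro ⟨⟨⟨N⟩, (hN : M N)⟩⟩ x
    obtain ⟨ε, rfl⟩ := extElem_surjective hN x
    obtain ⟨c, rfl⟩ := hδ N hN ε
    exact ⟨_, ofExtension_app h₀ hN δ c⟩
  · rintro ⟨⟨⟨N⟩, (hN : M N)⟩⟩ c hc
    obtain ⟨c, rfl⟩ := SubQuotient.exists_hom c
    have h₂ := (ofExtension_app h₀ hN δ c).symm.trans hc
    obtain ⟨c', hc'⟩ := hker N hN c (extElem_injective hN (h₂.trans (extElem_zero hN).symm))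
    refine ⟨quotientHom M hN h₁ c', InducedCategory.hom_ext ?_⟩
    exact ((toAddQuotient S.Proj).map_comp c' g).symm.trans hc'

end ExtModule

end ExtStructure

namespace ExtStructure

open ZeroObject

set_option linter.unusedSectionVars false

/-! ### Hearts as categories of coherent functors -/

section HeartEquivalence

variable {B : Type u} [Category.{v} B] [Preadditive B] [HasZeroObject B] [HasBinaryBiproducts B]
  {S : ExtStructure.{w} B} [S.IsExtriangulated] [S.EnoughProj] [S.EnoughInj]
  {n : ℕ} {M U V : ObjectProperty B}

/-- All extensions by `X` are pullbacks of `X ⟶ I ⟶ ΣX`. An approximation `N₀ ⟶ ΣX` gives a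
universal one over `M`, and an approximation of its middle term gives the weak kernel. -/
lemma IsClusterTilting.isCoherentFunctor_extModule (hM : S.IsClusterTilting n M) (X : B) :
    IsCoherentFunctor (SubQuotient M S.Proj) (S.extModule M X) := by
  obtain ⟨I, a, b, hI, θ, h⟩ := S.sigma_spec X
  obtain ⟨-, N₀, -, p, h₀, -, hp⟩ := hM.exists_deflation (S.sigma X)
  obtain ⟨E, x, y, hE⟩ := exists_realizes (pull p θ)
  obtain ⟨-, N₁, -, r, h₁, -, hr⟩ := hM.exists_deflation E
  obtain ⟨w, hw⟩ := isCokernel_ofExtension h₀ h₁ (pull p θ) (r ≫ y)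
    (by rw [pull_comp, hE.pull_eq_zero, pull_zero])
    (fun N hN ε => by
      obtain ⟨c, rfl⟩ := h.exists_pull_eq ε (hI _ _)
      obtain ⟨c', rfl⟩ := hp N c hN
      exact ⟨c', (pull_comp _ _ _).symm⟩)
    (fun N hN c hc => by
      obtain ⟨c', rfl⟩ := hE.exists_lift c hc
      obtain ⟨c'', rfl⟩ := hr N c' hN
      exact ⟨c'', by rw [Category.assoc]⟩)
  exact ⟨_, _, _, _, w, hw⟩

/-- For `G` the cokernel of `f : N₁ ⟶ N₀`, take `X` to be the kernel of `(f, p) : N₁ ⊞ P ⟶ N₀`,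
where `p` is a deflation from a projective. The summand `P` is invisible in `M / P`, and `E(M, N₁ ⊞
P) = 0`. -/
lemma IsClusterTilting.exists_extModule_iso (hM : S.IsClusterTilting n M) (hn : 2 ≤ n)
    (G : CoherentMod (SubQuotient M S.Proj)) :
    ∃ X : B, S.CoCone M M X ∧ Nonempty (S.extModule M X ≅ G.obj) := by
  obtain ⟨G, ⟨⟨⟨N₁⟩, (h₁ : M N₁)⟩, ⟨⟨N₀⟩, (h₀ : M N₀)⟩, f, q, w, ⟨hG⟩⟩⟩ := G
  obtain ⟨f, rfl⟩ := SubQuotient.exists_hom f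
  obtain ⟨P, k, p, hP, hp⟩ := S.omega_spec N₀
  obtain ⟨X, l, δ, hδ⟩ := hp.exists_desc_deflation f
  have hN := hM.mem_biprod h₁ (hM.mem_of_proj hP)
  obtain ⟨w', ⟨hX⟩⟩ := isCokernel_ofExtension h₀ h₁ δ f
    (by
      have := congrArg (pull (biprod.inl : N₁ ⟶ N₁ ⊞ P)) hδ.pull_eq_zero
      rwa [← pull_comp, biprod.inl_desc, pull_zero] at this)
    (fun N hN' ε => hδ.exists_pull_eq ε
      ((hM.mem_iff_hOrth_right _).1 hN 0 (by omega) N hN' _))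
    (fun N hN c hc => by
      obtain ⟨c', rfl⟩ := hδ.exists_lift c hc
      refine ⟨c' ≫ biprod.fst, CategoryTheory.Quotient.sound _ ⟨P, c' ≫ biprod.snd, -p, hP, ?_⟩⟩
      have := congrArg (c' ≫ · ≫ biprod.desc f p) (biprod.total (X := N₁) (Y := P))
      simp only [Preadditive.add_comp, Preadditive.comp_add, Category.assoc, biprod.inl_desc,
        biprod.inr_desc, Category.id_comp] at this
      rw [← this]
      simp)
  exact ⟨X, ⟨_, _, _, _, hN, h₀, δ, hδ⟩, ⟨hX.coconePointUniqueUpToIso hG⟩⟩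

/-- The functor `X ↦ E(-, X)` from `B` to `mod (M / P)`. -/
noncomputable def modFunctor (hM : S.IsClusterTilting n M) :
    B ⥤ CoherentMod (SubQuotient M S.Proj) :=
  (IsCoherentFunctor (SubQuotient M S.Proj)).lift (S.extFunctor M) hM.isCoherentFunctor_extModule

/-- A cotorsion pair `(U, V)` such that `M ⊆ U`, `E(M, U) = 0` and every object of `U` has a
presentation by an object of `M` with kernel in `U`. -/
structure IsResolvedBy (S : ExtStructure.{w} B) (M U V : ObjectProperty B) : Prop where
  cotorsion : S.IsCotorsionPair U V
  le : ∀ X, M X → U X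
  orth : ∀ X Y, M X → U Y → S.Orth X Y
  resolution : ∀ X, U X → ∃ (K N : B) (k : K ⟶ N) (p : N ⟶ X), U K ∧ M N ∧ S.IsConflation k p

/-! ### The functor `E(-, X)` on the heart. -/

namespace IsResolvedBy

variable (h : S.IsResolvedBy M U V)
include h

/-- Pull the defining conflation `X ⟶ Z ⟶ C` of `B⁻` back along `N ⟶ C` from the resolution of `C`.
The middle term is an extension of `Z` by `K`; universality uses `E(M, Z) = 0` and `E(M, K) = 0`. -/
lemma exists_presentation {X : B} (hX : S.minus U V X) :
    ∃ (E N : B) (x : X ⟶ E) (y : E ⟶ N) (δ : S.Ext N X), U E ∧ M N ∧ Realizes x y δ ∧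
      ∀ N', M N' → ∀ ε : S.Ext N' X, ∃ c : N' ⟶ N, pull c δ = ε := by
  obtain ⟨Z, C, a, b, hZ, hC, θ, h₁⟩ := hX
  obtain ⟨K, N, k, p, hK, hN, κ, h₂⟩ := h.resolution C hC
  obtain ⟨Q, i₁, p₁, i₂, p₂, h₃, h₄⟩ := h₂.exists_pullback h₁
  refine ⟨Q, N, i₂, p₂, pull p θ, h.cotorsion.left_of_conflation h₃ hK hZ.1, hN, h₄,
    fun N' hN' ε => ?_⟩
  obtain ⟨c, rfl⟩ := h₁.exists_pull_eq ε (h.orth N' Z hN' hZ.1 _)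
  obtain ⟨c', rfl⟩ := h₂.exists_lift c (h.orth N' K hN' hK _)
  exact ⟨c', (pull_comp _ _ _).symm⟩

/-- By universality of `δ`, `α` is determined by `ε = α(δ)`. It suffices to show `y^* ε = 0`, for
then `ε = f_* δ` and `f` induces `α`. -/
lemma extFunctor_map_surjective {X Y : B} (hX : S.minus U V X) (hY : S.plus U V Y)
    (α : S.extModule M X ⟶ S.extModule M Y) : ∃ f : X ⟶ Y, (S.extFunctor M).map f = α := by
  obtain ⟨E, N, x, y, δ, hE, hN, hr, hδ⟩ := h.exists_presentation hX
  obtain ⟨ε, hε⟩ := extElem_surjective hN (α.app _ (S.extElem hN δ))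
  have key : ∀ N' (hN' : M N') (c : N' ⟶ N),
      α.app _ (S.extElem hN' (pull c δ)) = S.extElem hN' (pull c ε) := fun N' hN' c => by
    rw [← extModule_map hN hN' c ε, hε, ← extModule_map hN hN' c δ]
    exact congrArg (fun r => r (S.extElem hN δ)) (α.naturality (quotientHom M hN' hN c).op)
  -- Naturality only tests `y^* ε` on objects of `M`, and `E` need not lie in `M`. After restriction
  -- to `N₁` it vanishes, so it is `φ_* κ`; as `φ : K ⟶ Y` factors through the core and `E(U, W) =
  -- 0`, it vanishes already on `E`.
  obtain ⟨K, N₁, k, p, hK, hN₁, κ, hκ⟩ := h.resolution E hE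
  have h₁ : pull p (pull y ε) = 0 := by
    apply extElem_injective hN₁
    rw [← pull_comp, ← key N₁ hN₁, pull_comp, hr.pull_eq_zero, pull_zero, extElem_zero,
      extElem_zero, map_zero]
  obtain ⟨φ, hφ⟩ := hκ.exists_push_eq _ h₁
  obtain ⟨T, a, b, hT, rfl⟩ := h.cotorsion.exists_factor_plus hK hY φ
  rw [push_comp, h.cotorsion.ext_eq_zero E T hE hT.2 (push a κ), push_zero] at hφ
  obtain ⟨f, rfl⟩ := hr.exists_push_eq ε hφ.symm
  refine ⟨f, ?_⟩
  ext ⟨⟨⟨N'⟩, (hN' : M N')⟩⟩ z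
  obtain ⟨ε, rfl⟩ := extElem_surjective hN' z
  obtain ⟨c, rfl⟩ := hδ N' hN' ε
  refine (extFunctor_map_app hN' f _).trans ?_
  rw [← pull_push]
  exact (key N' hN' c).symm

/-- If `f - g` kills the universal extension, it extends to the middle term in `U`, and morphisms
from `U` to `B⁺` factor through the core. -/
lemma idealRel_of_extFunctor_map_eq {X Y : B} (hX : S.minus U V X) (hY : S.plus U V Y)
    (f g : X ⟶ Y) (hfg : (S.extFunctor M).map f = (S.extFunctor M).map g) :
    idealRel (U ⊓ V) f g := by
  obtain ⟨E, N, x, y, δ, hE, hN, hr, hδ⟩ := h.exists_presentation hX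
  have h₁ := (extFunctor_map_eq_iff f g).1 hfg N hN δ
  obtain ⟨k, hk⟩ := hr.exists_extension (f - g) (by rw [push_sub, h₁, sub_self])
  obtain ⟨T, a, b, hT, rfl⟩ := h.cotorsion.exists_factor_plus hE hY k
  exact ⟨T, x ≫ a, b, hT, by rw [Category.assoc, hk]⟩

lemma extFunctor_map_eq_of_idealRel {X Y : B} (f g : X ⟶ Y) (hfg : idealRel (U ⊓ V) f g) :
    (S.extFunctor M).map f = (S.extFunctor M).map g := by
  obtain ⟨Z, a, b, hZ, hab⟩ := hfg
  refine (extFunctor_map_eq_iff f g).2 fun N hN δ => ?_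
  rw [← sub_eq_zero, ← push_sub, ← hab, push_comp, h.orth N Z hN hZ.1 (push a δ), push_zero]

/-- The functor from `B / W` to `mod (M / P)` induced by `X ↦ E(-, X)`. -/
noncomputable def quotientModFunctor (hM : S.IsClusterTilting n M) :
    AddQuotient (U ⊓ V) ⥤ CoherentMod (SubQuotient M S.Proj) :=
  CategoryTheory.Quotient.lift _ (modFunctor hM) fun _ _ f g hfg =>
    InducedCategory.hom_ext (h.extFunctor_map_eq_of_idealRel f g hfg)

/-- The functor from the heart to `mod (M / P)` induced by `X ↦ E(-, X)`. -/
noncomputable def heartModFunctor (hM : S.IsClusterTilting n M) :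
    S.Heart U V ⥤ CoherentMod (SubQuotient M S.Proj) :=
  subQuotientIncl (S.plus U V ⊓ S.minus U V) (U ⊓ V) ⋙ h.quotientModFunctor hM

variable (hM : S.IsClusterTilting n M)

lemma isIso_quotientModFunctor_map {X Y : B} (f : X ⟶ Y) (hf : S.ExtIso M f) :
    IsIso ((h.quotientModFunctor hM).map ((toAddQuotient (U ⊓ V)).map f)) := by
  rw [← ObjectProperty.isIso_hom_iff]
  exact isIso_extFunctor_map f hf

lemma full_heartModFunctor : (h.heartModFunctor hM).Full where
  map_surjective {X Y} α := by
    obtain ⟨f, hf⟩ := h.extFunctor_map_surjective X.property.2 Y.property.1 α.hom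
    exact ⟨ObjectProperty.homMk ((toAddQuotient (U ⊓ V)).map f), InducedCategory.hom_ext hf⟩

lemma faithful_heartModFunctor : (h.heartModFunctor hM).Faithful where
  map_injective {X Y} f g hfg := by
    obtain ⟨f, rfl⟩ := SubQuotient.exists_hom f
    obtain ⟨g, rfl⟩ := SubQuotient.exists_hom g
    have h₁ : (S.extFunctor M).map f = (S.extFunctor M).map g :=
      congrArg (fun φ => φ.hom) hfg
    exact InducedCategory.hom_ext ((h.cotorsion.toAddQuotient_map_eq_iff f g).2
      (h.idealRel_of_extFunctor_map_eq X.property.2 Y.property.1 f g h₁))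

/-- The object realizing `G` is in `CoCone(M, M) ⊆ B⁻`; its reflection onto `B⁺` stays in `B⁻` and
has the same `E(-, X)`. -/
lemma essSurj_heartModFunctor (hn : 2 ≤ n) : (h.heartModFunctor hM).EssSurj where
  mem_essImage G := by
    obtain ⟨X, ⟨N, N', a, b, hN, hN', hX⟩, ⟨e⟩⟩ := hM.exists_extModule_iso hn G
    have hX' : S.minus U V X :=
      h.cotorsion.minus_of_cocone ⟨N, N', a, b, h.le N hN, h.le N' hN', hX⟩
    obtain ⟨Y, C, D, x, y, u, θ, hY, hC, hD, hr⟩ := h.cotorsion.exists_plus X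
    have := isIso_extFunctor_map x (h.cotorsion.extIso_plus h.orth hC hD hr)
    exact ⟨⟨⟨Y⟩, hY, h.cotorsion.minus_plus hC ⟨_, hr⟩ hX'⟩,
      ⟨ObjectProperty.isoMk _ ((asIso ((S.extFunctor M).map x)).symm ≪≫ e)⟩⟩

lemma isEquivalence_heartModFunctor (hn : 2 ≤ n) : (h.heartModFunctor hM).IsEquivalence where
  faithful := h.faithful_heartModFunctor hM
  full := h.full_heartModFunctor hM
  essSurj := h.essSurj_heartModFunctor hM hn

lemma exists_isHeartFunctor : ∃ H : B ⥤ S.Heart U V, S.IsHeartFunctor U V H := by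
  obtain ⟨σp, adj, hp⟩ := h.cotorsion.exists_reflection h.orth
  obtain ⟨σm, adj', hm⟩ := h.cotorsion.exists_coreflection h.le
  refine ⟨(inAddQuotient (S.plus U V ⊓ S.minus U V) (U ⊓ V)).lift
    (toAddQuotient (U ⊓ V) ⋙ σp ⋙ subQuotientIncl (S.plus U V) (U ⊓ V) ⋙
        σm ⋙ subQuotientIncl (S.minus U V) (U ⊓ V)) fun X => ⟨?_, ?_⟩,
    σp, σm, ⟨adj⟩, ⟨adj'⟩, ⟨Iso.refl _⟩⟩
  · exact (hm _).1 (σp.obj _).property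
  · exact (σm.obj _).property

/-- The functor `X ↦ E(-, X)` is the associated functor followed by the equivalence of the heart
with `mod (M / P)`. -/
lemma nonempty_heartFunctor_comp_iso (H : B ⥤ S.Heart U V) (hH : S.IsHeartFunctor U V H) :
    Nonempty (H ⋙ h.heartModFunctor hM ≅ modFunctor hM) := by
  obtain ⟨τp, τm, ⟨adjp⟩, ⟨adjm⟩, ⟨e⟩⟩ := hH
  obtain ⟨σp, adj, hp⟩ := h.cotorsion.exists_reflection h.orth
  obtain ⟨σm, adj', hm⟩ := h.cotorsion.exists_coreflection h.le
  let Q := h.quotientModFunctor hM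
  have i₁ : IsIso (Functor.whiskerRight adj.unit Q) := by
    have : ∀ X, IsIso ((Functor.whiskerRight adj.unit Q).app X) := fun X => by
      obtain ⟨f, hf, hf'⟩ := (hp X).2
      rw [Functor.whiskerRight_app, hf]
      exact h.isIso_quotientModFunctor_map hM f hf'
    exact NatIso.isIso_of_isIso_app _
  have i₂ : IsIso (Functor.whiskerRight adj'.counit Q) := by
    have : ∀ X, IsIso ((Functor.whiskerRight adj'.counit Q).app X) := fun X => by
      obtain ⟨f, hf, hf'⟩ := (hm X).2
      rw [Functor.whiskerRight_app, hf]
      exact h.isIso_quotientModFunctor_map hM f hf'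
    exact NatIso.isIso_of_isIso_app _
  let ip := subQuotientIncl (S.plus U V) (U ⊓ V)
  let im := subQuotientIncl (S.minus U V) (U ⊓ V)
  -- The adjoints in `hH` are arbitrary. Uniqueness of adjoints replaces them by the constructed
  -- ones, whose unit and counit `Q` inverts.
  let em : (τm ⋙ im) ⋙ Q ≅ Q :=
    Functor.isoWhiskerRight (Functor.isoWhiskerRight (adjm.rightAdjointUniq adj') im) Q ≪≫
      asIso (Functor.whiskerRight adj'.counit Q)
  let ep : (τp ⋙ ip) ⋙ Q ≅ Q :=
    Functor.isoWhiskerRight (Functor.isoWhiskerRight (adjp.leftAdjointUniq adj) ip) Q ≪≫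
      (asIso (Functor.whiskerRight adj.unit Q)).symm
  exact ⟨Functor.isoWhiskerRight e Q ≪≫
    Functor.isoWhiskerLeft (toAddQuotient (U ⊓ V) ⋙ τp ⋙ ip) em ≪≫
    Functor.isoWhiskerLeft (toAddQuotient (U ⊓ V)) ep ≪≫ CategoryTheory.Quotient.lift.isLift _ _ _⟩

end IsResolvedBy

lemma IsClusterTilting.isResolvedBy (hM : S.IsClusterTilting n M) {j k : ℕ} (hn : j + k + 2 = n) :
    S.IsResolvedBy M (S.coneIter M j) (S.cosyzygy (S.coneIter M k) j) where
  cotorsion := hM.isCotorsionPair hn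
  le _ hX := hM.coneIter_of_mem (by omega) (by omega) hX
  orth X Y hX hY := (hM.coneIter_iff (by omega) j (by omega) Y).1 hY 0 (by omega) X hX
  resolution X hX := by
    obtain ⟨K, N, x, p, hN, h, hp⟩ := hM.exists_deflation X
    -- `m = n - j - 2` is the last index in the vanishing range of `M_(j+1)`; for `K` to have
    -- vanishing up to `m`, only the indices below `m` are needed for `X`.
    refine ⟨K, N, x, p, (hM.coneIter_iff (by omega) j (by omega) K).2 fun i hi Y hY => ?_, hN, h⟩
    exact hM.hOrth_of_approximation (by omega) hN h hp (m := n - j - 2) (by omega)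
      (fun i hi => (hM.coneIter_iff (by omega) j (by omega) X).1 hX i (by omega)) i (by omega) hY

lemma IsResolvedBy.heartEquivalent (hM : S.IsClusterTilting n M) (hn : 2 ≤ n)
    {U' V' : ObjectProperty B} (h : S.IsResolvedBy M U V) (h' : S.IsResolvedBy M U' V') :
    S.HeartEquivalent U V U' V' := by
  have := h.isEquivalence_heartModFunctor hM hn
  have := h'.isEquivalence_heartModFunctor hM hn
  refine ⟨h.exists_isHeartFunctor, h'.exists_isHeartFunctor,
    (h.heartModFunctor hM).asEquivalence.trans (h'.heartModFunctor hM).asEquivalence.symm,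
    fun H H' hH hH' => ?_⟩
  obtain ⟨e⟩ := h.nonempty_heartFunctor_comp_iso hM H hH
  obtain ⟨e'⟩ := h'.nonempty_heartFunctor_comp_iso hM H' hH'
  exact ⟨Functor.isoWhiskerRight (e ≪≫ e'.symm) (h'.heartModFunctor hM).inv ≪≫
    Functor.isoWhiskerLeft H' (h'.heartModFunctor hM).asEquivalence.unitIso.symm⟩

end HeartEquivalence

end ExtStructure

theorem mainTheorem8 {B : Type u} [Category.{v} B] [Preadditive B] [HasZeroObject B] [HasBinaryBiproducts B]
    (S : ExtStructure.{w} B) [S.IsExtriangulated] [S.EnoughProj] [S.EnoughInj]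
    (n : ℕ) (hn : 2 ≤ n) (M : ObjectProperty B) (hM : S.IsClusterTilting n M) :
    (∀ ℓ : ℕ, 1 ≤ ℓ → ℓ ≤ n - 1 → S.IsCotorsionPair (S.MSub M ℓ) (S.YSub M n ℓ)) ∧
    (∀ k ℓ : ℕ, 1 ≤ k → k ≤ n - 1 → 1 ≤ ℓ → ℓ ≤ n - 1 →
      S.HeartEquivalent (S.MSub M k) (S.YSub M n k) (S.MSub M ℓ) (S.YSub M n ℓ)) ∧
    (∀ ℓ : ℕ, 1 ≤ ℓ → ℓ ≤ n - 1 →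
      Nonempty (S.Heart (S.MSub M ℓ) (S.YSub M n ℓ) ≌ CoherentMod (SubQuotient M S.Proj))) := by

  have key : ∀ ℓ : ℕ, 1 ≤ ℓ → ℓ ≤ n - 1 → S.IsResolvedBy M (S.MSub M ℓ) (S.YSub M n ℓ) :=
    -- Here `j = ℓ - 1` and `k = n - ℓ - 1`.
    fun ℓ h₁ h₂ => hM.isResolvedBy (by omega)
  refine ⟨fun ℓ h₁ h₂ => (key ℓ h₁ h₂).cotorsion, fun k ℓ h₁ h₂ h₃ h₄ =>
    (key k h₁ h₂).heartEquivalent hM hn (key ℓ h₃ h₄), fun ℓ h₁ h₂ => ?_⟩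
  have := (key ℓ h₁ h₂).isEquivalence_heartModFunctor hM hn
  exact ⟨((key ℓ h₁ h₂).heartModFunctor hM).asEquivalence⟩
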